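/- Theorem D.1. Let $\mathcal U\subset\mathbb R^p$ be compact and convex with piecewise $C^1$ boundary, and let $\mu$ be an absolutely continuous probability measure with support $\mathcal U$. Let $\mathcal D,\mathcal Z$ be finite sets. **Model.** Random variables $((Y_d)_{d\in\mathcal D},D,Z,(U_d)_{d\in\mathcal D})$, with $Y_d,U_d$ valued in $\mathbb R^p$, $D$ in $\mathcal D$ and $Z$ in $\mathcal Z$, *satisfy the IV multivariate quantile regression model with structural function* $q=(q_d)_{d\in\mathcal D}$, $q_d:\mathcal U\to\mathbb R^p$, if: for each $d$, $U_d\sim\mu$, $Y_d=q_d(U_d)$ almost surely, and $q_d$ is continuous on $\mathcal U$ and continuously differentiable on $\mathrm{Int}(\mathcal U)$ with symmetric positive definite derivative there; each $U_d$ is independent of $Z$; $D=\delta(Z,\nu)$ almost surely for some measurable $\delta$ and some random element $\nu$; and, conditionally on $(Z,\nu)$, the $U_d$, $d\in\mathcal D$, are identically distributed. (Covariates are suppressed: everything is conditional on a fixed value of them.) The observables are $(Y,D,Z)$ with $Y=Y_D$. **Function spaces.** For compact $S\subset\mathbb R^p$, $C^k(S;\mathbb R^s)$ is the set of continuous functions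 on $S$ that are $k$ times continuously differentiable on $\mathrm{Int}(S)$ with derivatives up to order $k$ extending continuously to $S$. Let $\mathcal Q=(C^2(\mathcal U;\mathbb R^p))^{\mathcal D}$ with norm $\|q\|_{\mathcal Q}=\max_{d}\max_{i}\sup_{u\in\mathcal U}|q_d^i(u)|$. Fix $\overline\lambda>\underline\lambda>0$ and $K>0$. Let $\tilde{\mathcal Q}$ be the set of $q\in\mathcal Q$ such that, for every $d$, $Dq_d$ is symmetric positive definite on $\mathrm{Int}(\mathcal U)$ with all eigenvalues in $(\underline\lambda,\overline\lambda)$. Given $q^\ast$, let $$\mathcal Q_0=\{q^\ast+\alpha h\in\tilde{\mathcal Q}\;:\;\alpha\ge 0,\ h\in\mathcal Q,\ \|h\|_{\mathcal Q}=1,\ \max_d\|Dh_d\|_\infty\le K\},$$ where $\|Dh_d\|_\infty$ is the supremum over $\mathrm{Int}(\mathcal U)$ of the Euclidean operator norm of $Dh_d$. **Identification.** Suppose $((Y_d),D,Z,(U_d))$ satisfies the model with structural function $q^\ast$. For a set $\mathcal R$ of functions, $q^\ast$ is *identified in* $\mathcal R$ if, whenever $((\tilde Y_d),\tilde D,\tilde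 Z,(\tilde U_d))$ satisfies the model with some $q\in\mathcal R\setminus\{q^\ast\}$, the joint distribution of $(\tilde Y_{\tilde D},\tilde D,\tilde Z)$ differs from that of $(Y,D,Z)$. It is *locally identified in* $\mathcal Q_0$ if for some $\varepsilon>0$ it is identified in $\{q\in\mathcal Q_0:\|q-q^\ast\|_{\mathcal Q}<\varepsilon\}$. **Theorem.** Suppose that $((Y_d),D,Z,(U_d))$ satisfies the model with structural function $q^\ast$, that $P(Z=z)>0$ for all $z\in\mathcal Z$, and that 1. $q^\ast\in\mathcal Q_0$; 2. for each $d$ the support $\mathcal Y_d$ of the distribution of $Y_d$ is compact and convex with piecewise $C^2$ boundary; 3. for all $(d,z)$ the measure $B\mapsto P(Y\in B,\,D=d\mid Z=z)$ has a nonnegative density $f_{d,z}\in C^1(\mathcal Y_d;\mathbb R)$ on $\mathcal Y_d$; 4. there is a constant matrix $b\in\mathbb R^{|\mathcal D|\times|\mathcal Z|}$ such that, for $\mu$-almost every $u\in\mathcal U$, $$\sum_{d,d'\in\mathcal D}\Big(\sum_{z\in\mathcal Z}b_{d',z}\,f_{d,z}(q_d^\ast(u))\Big)\det(Dq_d^\ast(u))\,\xi_{d'}'\,(Dq_d^\ast(u))^{-1}\xi_d>0\quad\text{for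 all }(\xi_d)_{d\in\mathcal D}\in(\mathbb R^p)^{\mathcal D}\setminus\{0\}.$$ Then $q^\ast$ is locally identified in $\mathcal Q_0$. -/

import Mathlib

open MeasureTheory ProbabilityTheory

universe w₁ w₂ w₃ w₄

namespace IVQR

/-- `p`-dimensional Euclidean space. -/
abbrev Eucl (p : ℕ) : Type := EuclideanSpace ℝ (Fin p)

/-! ### Function spaces and boundaries -/

/-- `f ∈ C^k(K; F)`: `f` is continuous on `K`, is `k` times continuously differentiable on the
interior of `K`, and its derivatives up to order `k` extend continuously to `K`.
Only the values of `f` on `K` matter. -/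
def MemC {p : ℕ} {F : Type*} [NormedAddCommGroup F] [NormedSpace ℝ F]
    (k : ℕ) (K : Set (Eucl p)) (f : Eucl p → F) : Prop :=
  ContinuousOn f K ∧ ContDiffOn ℝ k f (interior K) ∧
    ∀ j ≤ k, ∃ g : Eucl p → ContinuousMultilinearMap ℝ (fun _ : Fin j => Eucl p) F,
      ContinuousOn g K ∧ Set.EqOn g (iteratedFDeriv ℝ j f) (interior K)

/-- `S` is an embedded `C^k` hypersurface (not necessarily closed): near each of its points it is
the zero set of a `C^k` function with nonvanishing derivative. -/
def IsHypersurface {p : ℕ} (k : ℕ) (S : Set (Eucl p)) : Prop :=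
  ∀ x ∈ S, ∃ (W : Set (Eucl p)) (ρ : Eucl p → ℝ),
    IsOpen W ∧ x ∈ W ∧ ContDiffOn ℝ k ρ W ∧ (∀ y ∈ W, fderiv ℝ ρ y ≠ 0) ∧
      S ∩ W = {y ∈ W | ρ y = 0}

/-- The boundary of `K` is piecewise `C^k`: it consists of finitely many pieces, each of which is
part of a `C^k` hypersurface. -/
def HasPiecewiseBoundary {p : ℕ} (k : ℕ) (K : Set (Eucl p)) : Prop :=
  ∃ (n : ℕ) (S : Fin n → Set (Eucl p)),
    (∀ i, IsHypersurface k (S i)) ∧ frontier K ⊆ ⋃ i, S i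

/-- The Jacobian matrix `Dg(u)`, with entries `∂g^i/∂u^j`. It is used at interior points of `𝒰`,
where it depends only on the values of `g` on `𝒰`. -/
noncomputable def jac {p : ℕ} (g : Eucl p → Eucl p) (u : Eucl p) : Matrix (Fin p) (Fin p) ℝ :=
  Matrix.of fun i j => fderiv ℝ g u (EuclideanSpace.single j 1) i

/-- `‖g‖_∞ = max_i sup_{u ∈ 𝒰} |g^i(u)|`. -/
noncomputable def supNorm {p : ℕ} (𝒰 : Set (Eucl p)) (g : Eucl p → Eucl p) : ℝ :=
  ⨆ i : Fin p, ⨆ u : 𝒰, |g u i|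

section Model

variable {p : ℕ} {𝒟 : Type w₃} {𝒵 : Type w₄} [MeasurableSpace 𝒟] [MeasurableSpace 𝒵]

/-- `‖q‖_𝒬 = max_d ‖q_d‖_∞`. -/
noncomputable def normQ (𝒰 : Set (Eucl p)) (q : 𝒟 → Eucl p → Eucl p) : ℝ :=
  ⨆ d, supNorm 𝒰 (q d)

/-- `𝒬 = (C²(𝒰; ℝ^p))^𝒟`. Its elements are represented by functions on `ℝ^p`, of which only the
values on `𝒰` matter. -/
def spaceQ (𝒰 : Set (Eucl p)) : Set (𝒟 → Eucl p → Eucl p) :=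
  {q | ∀ d, MemC 2 𝒰 (q d)}

/-- `𝒬̃`: the elements of `𝒬` whose derivatives are symmetric positive definite with all their
eigenvalues strictly between `lo` and `hi`. -/
def spaceQTilde (𝒰 : Set (Eucl p)) (lo hi : ℝ) : Set (𝒟 → Eucl p → Eucl p) :=
  {q | q ∈ spaceQ 𝒰 ∧ ∀ d, ∀ u ∈ interior 𝒰,
    (jac (q d) u).PosDef ∧
      ∀ t : ℝ, Module.End.HasEigenvalue (Matrix.toLin' (jac (q d) u)) t → lo < t ∧ t < hi}

/-- `𝒬₀`: the elements of `𝒬̃` of the form `q⋆ + α h` with `α ≥ 0`, `h ∈ 𝒬`, `‖h‖_𝒬 = 1` and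
`max_d ‖D h_d‖_∞ ≤ K`, the derivatives being measured in the Euclidean operator norm. -/
def spaceQ0 (𝒰 : Set (Eucl p)) (lo hi K : ℝ) (qs : 𝒟 → Eucl p → Eucl p) :
    Set (𝒟 → Eucl p → Eucl p) :=
  {q | q ∈ spaceQTilde 𝒰 lo hi ∧
    ∃ (α : ℝ) (h : 𝒟 → Eucl p → Eucl p), 0 ≤ α ∧ h ∈ spaceQ 𝒰 ∧ normQ 𝒰 h = 1 ∧
      (∀ d, ∀ u ∈ interior 𝒰, ‖fderiv ℝ (h d) u‖ ≤ K) ∧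
      ∀ d, ∀ u ∈ 𝒰, q d u = qs d u + α • h d u}

/-- The observed outcome `Y = Y_D`. -/
def observed {Ω : Type*} (Y : 𝒟 → Ω → Eucl p) (D : Ω → 𝒟) : Ω → Eucl p :=
  fun ω => Y (D ω) ω

/-- The IV multivariate quantile regression model, conditionally on a fixed covariate value (so that
covariates are suppressed): the potential outcomes `Y_d`, the treatment `D`, the instrument `Z` and
the ranks `U_d` on the probability space `(Ω, P)`, together with the random element `ν` entering the
assignment of the treatment, satisfy the model with structural function `q`. -/
structure IsModel (𝒰 : Set (Eucl p)) (μ : Measure (Eucl p))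
    {Ω : Type*} [MeasurableSpace Ω] (P : Measure Ω)
    {N : Type*} [MeasurableSpace N] (Y : 𝒟 → Ω → Eucl p) (D : Ω → 𝒟) (Z : Ω → 𝒵)
    (U : 𝒟 → Ω → Eucl p) (ν : Ω → N) (q : 𝒟 → Eucl p → Eucl p) : Prop where
  measurable_Y : ∀ d, Measurable (Y d)
  measurable_D : Measurable D
  measurable_Z : Measurable Z
  measurable_U : ∀ d, Measurable (U d)
  measurable_ν : Measurable ν
  /-- the ranks follow the reference distribution -/
  law_U : ∀ d, P.map (U d) = μ
  /-- the structural equation `Y_d = q_d(U_d)` almost surely -/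
  structural : ∀ d, ∀ᵐ ω ∂P, Y d ω = q d (U d ω)
  continuousOn_q : ∀ d, ContinuousOn (q d) 𝒰
  contDiffOn_q : ∀ d, ContDiffOn ℝ 1 (q d) (interior 𝒰)
  /-- the derivative is symmetric and positive definite -/
  posDef_jac : ∀ d, ∀ u ∈ interior 𝒰, (jac (q d) u).PosDef
  /-- the ranks are independent of the instrument -/
  indep : ∀ d, IndepFun (U d) Z P
  /-- the treatment is a function of the instrument and of `ν` -/
  selection : ∃ δ : 𝒵 × N → 𝒟, Measurable δ ∧ ∀ᵐ ω ∂P, D ω = δ (Z ω, ν ω)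
  /-- rank similarity: conditionally on `(Z, ν)`, the ranks are identically distributed -/
  rank_similarity : ∀ d d', ∀ B : Set (Eucl p), MeasurableSet B →
    P⟦U d ⁻¹' B | MeasurableSpace.comap (fun ω => (Z ω, ν ω)) inferInstance⟧ =ᵐ[P]
      P⟦U d' ⁻¹' B | MeasurableSpace.comap (fun ω => (Z ω, ν ω)) inferInstance⟧

/-- The joint distribution of the observables `(Y, D, Z)`. -/
noncomputable def observedLaw {Ω : Type*} [MeasurableSpace Ω] (P : Measure Ω)
    (Y : 𝒟 → Ω → Eucl p) (D : Ω → 𝒟) (Z : Ω → 𝒵) : Measure (Eucl p × 𝒟 × 𝒵) :=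
  P.map fun ω => (observed Y D ω, D ω, Z ω)

/-- The support `𝒴_d` of the distribution of the potential outcome `Y_d`. -/
def outcomeSupport {Ω : Type*} [MeasurableSpace Ω] (P : Measure Ω)
    (Y : 𝒟 → Ω → Eucl p) (d : 𝒟) : Set (Eucl p) :=
  (P.map (Y d)).support

/-- `f d z` is the density on `𝒴_d` of the measure `B ↦ P(Y ∈ B, D = d | Z = z)`. Since this measure
is carried by `𝒴_d`, the density vanishes off `𝒴_d`, and the values of the function `f d z` there
play no role. -/
def IsDensityFamily {Ω : Type*} [MeasurableSpace Ω] (P : Measure Ω)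
    (Y : 𝒟 → Ω → Eucl p) (D : Ω → 𝒟) (Z : Ω → 𝒵) (f : 𝒟 → 𝒵 → Eucl p → ℝ) : Prop :=
  ∀ d z, (∀ y ∈ outcomeSupport P Y d, 0 ≤ f d z y) ∧
    ((P[|Z ⁻¹' {z}]).restrict (D ⁻¹' {d})).map (observed Y D) =
      (volume.restrict (outcomeSupport P Y d)).withDensity fun y => ENNReal.ofReal (f d z y)

/-- The structural function `qs` is identified in the class `Q` from the distribution `L` of the
observables: no model whose structural function lies in `Q` and differs from `qs` on `𝒰` induces
the distribution `L`. -/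
def IsIdentified (𝒰 : Set (Eucl p)) (μ : Measure (Eucl p))
    (L : Measure (Eucl p × 𝒟 × 𝒵)) (Q : Set (𝒟 → Eucl p → Eucl p))
    (qs : 𝒟 → Eucl p → Eucl p) : Prop :=
  ∀ (Ω : Type w₁) [MeasurableSpace Ω] (P : Measure Ω) [IsProbabilityMeasure P]
    (N : Type w₂) [MeasurableSpace N] (Y : 𝒟 → Ω → Eucl p) (D : Ω → 𝒟) (Z : Ω → 𝒵)
    (U : 𝒟 → Ω → Eucl p) (ν : Ω → N) (q : 𝒟 → Eucl p → Eucl p),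
    q ∈ Q → (∃ d, ¬ Set.EqOn (q d) (qs d) 𝒰) → IsModel 𝒰 μ P Y D Z U ν q →
      observedLaw P Y D Z ≠ L

/-- `qs` is locally identified in `Q`: it is identified in the intersection of `Q` with some
`‖·‖_𝒬`-ball around `qs`. -/
def IsLocallyIdentified (𝒰 : Set (Eucl p)) (μ : Measure (Eucl p))
    (L : Measure (Eucl p × 𝒟 × 𝒵)) (Q : Set (𝒟 → Eucl p → Eucl p))
    (qs : 𝒟 → Eucl p → Eucl p) : Prop :=
  ∃ ε : ℝ, 0 < ε ∧
    IsIdentified.{w₁, w₂, w₃, w₄} 𝒰 μ L {q ∈ Q | normQ 𝒰 (fun d u => q d u - qs d u) < ε} qs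

/-- The weighted quadratic form
`∑_{d,d'} (∑_z b_{d',z} f_{d,z}(q_d(u))) det(Dq_d(u)) ξ_{d'}' (Dq_d(u))⁻¹ ξ_d`. -/
noncomputable def weightedForm [Fintype 𝒟] [Fintype 𝒵] (b : Matrix 𝒟 𝒵 ℝ)
    (f : 𝒟 → 𝒵 → Eucl p → ℝ) (q : 𝒟 → Eucl p → Eucl p) (u : Eucl p)
    (ξ : 𝒟 → Fin p → ℝ) : ℝ :=
  ∑ d, ∑ d', (∑ z, b d' z * f d z (q d u)) * (jac (q d) u).det *
    (ξ d' ⬝ᵥ ((jac (q d) u)⁻¹.mulVec (ξ d)))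

end Model

end IVQR

/-! Suppose `q = qs + a • h`, with `a > 0` and `‖h‖ = 1`, induces the same observables as `qs`.
Inverting `q` at the observed outcome yields a rank `V` on the original probability space with
`q_D(V) = qs_D(U_D)`. In either model rank similarity makes the rank of the observed outcome
independent of the instrument with law `μ`, so `(V, Z)` and `(U_D, Z)` have the same distribution
and every test function `φ_Z` has equal means at `V` and at `U_D`.

The test function is chosen so that this equality produces the weighted form. The derivatives of `q`
and `qs` are symmetric, hence so is that of `h_d`, and `h_d = ∇ψ_d` on the convex interior of `𝒰`.
Take `φ_z = P(Z = z)⁻¹ ∑_{d'} b_{d',z} ψ_{d'}`. The equation for `V` gives `V - U_D = -a (Dqs_D)⁻¹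
h_D(U_D) + O(a²)`, and therefore `ψ_{d'}(V) - ψ_{d'}(U_D) = -a ⟨h_{d'}, (Dqs_D)⁻¹ h_D⟩(U_D) + O(a²)`
(`abs_expansion_le`). On taking means, the inverse probabilities cancel the law of `Z` and the
change of variables `y = qs_d(u)` brings in the densities: the first-order term is `-a` times the
integral of the weighted form along `h`. That integral is thus at most `C₂ a`, where `C₂` does not
depend on `h`.

Conversely, the integral is at least some `c > 0` uniformly in `h` (`exists_pos_le_integral_form`):
since `h` is `K`-Lipschitz of norm one, it stays away from zero on a ball of fixed radius, and on a
part of that ball of mass bounded below the form is uniformly positive definite. Hence `c ≤ C₂ a`,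
which fails for small `a = ‖q - qs‖`. -/

namespace IVQR

/-! ### Calculus of maps with symmetric positive definite derivative -/

section Analysis

variable {p : ℕ}

theorem jac_mulVec (g : Eucl p → Eucl p) (u x : Eucl p) :
    (jac g u).mulVec x.ofLp = (fderiv ℝ g u x).ofLp := by
  ext i
  have hx : x = ∑ j, x j • EuclideanSpace.single j (1 : ℝ) := by
    ext k
    simp [Finset.sum_apply, Pi.single_apply]
  conv_rhs => rw [hx]
  simp [jac, Matrix.mulVec, dotProduct, map_sum, mul_comm]

theorem det_fderiv_eq_det_jac (g : Eucl p → Eucl p) (u : Eucl p) :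
    (fderiv ℝ g u).det = (jac g u).det := by
  have h : (fderiv ℝ g u : Eucl p →ₗ[ℝ] Eucl p) =
      Matrix.toLin (EuclideanSpace.basisFun (Fin p) ℝ).toBasis
        (EuclideanSpace.basisFun (Fin p) ℝ).toBasis (jac g u) := by
    rw [← LinearMap.toMatrix_symm, LinearEquiv.eq_symm_apply]
    ext i j
    simp [jac, LinearMap.toMatrix_apply]
  rw [ContinuousLinearMap.det, h, LinearMap.det_toLin]

theorem inner_fderiv_comm {g : Eucl p → Eucl p} {u : Eucl p} (h : (jac g u).PosDef)
    (x y : Eucl p) : inner ℝ (fderiv ℝ g u x) y = inner ℝ (fderiv ℝ g u y) x := by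
  have hs : (jac g u).transpose = jac g u := by
    simpa [Matrix.IsHermitian] using h.isHermitian
  rw [EuclideanSpace.inner_eq_star_dotProduct, EuclideanSpace.inner_eq_star_dotProduct,
    ← jac_mulVec, ← jac_mulVec]
  simp only [star_trivial]
  rw [Matrix.dotProduct_mulVec, ← Matrix.mulVec_transpose, hs, dotProduct_comm]

/-- Subtracting `lo • 1` shifts every eigenvalue by `lo`, so the shifted symmetric matrix has
nonnegative spectrum. -/
theorem mul_sq_norm_le_inner_fderiv {g : Eucl p → Eucl p} {u : Eucl p} {lo : ℝ}
    (h : (jac g u).PosDef)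
    (ht : ∀ t : ℝ, Module.End.HasEigenvalue (Matrix.toLin' (jac g u)) t → lo < t) (x : Eucl p) :
    lo * ‖x‖ ^ 2 ≤ inner ℝ (fderiv ℝ g u x) x := by
  have hH : (jac g u - lo • (1 : Matrix (Fin p) (Fin p) ℝ)).IsHermitian := by
    refine h.isHermitian.sub ?_
    simp [Matrix.IsHermitian]
  have hps : (jac g u - lo • (1 : Matrix (Fin p) (Fin p) ℝ)).PosSemidef := by
    rw [hH.posSemidef_iff_eigenvalues_nonneg]
    intro i
    have hev := hH.mulVec_eigenvectorBasis i
    rw [Matrix.sub_mulVec, Matrix.smul_mulVec, Matrix.one_mulVec, sub_eq_iff_eq_add,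
      ← add_smul] at hev
    have := ht (hH.eigenvalues i + lo) (by
      refine Module.End.hasEigenvalue_of_hasEigenvector
        (x := (hH.eigenvectorBasis i).ofLp) ⟨?_, ?_⟩
      · rw [Module.End.mem_eigenspace_iff, Matrix.toLin'_apply, hev]
      · intro h0
        exact hH.eigenvectorBasis.orthonormal.ne_zero i (by ext j; simp [h0]))
    simp only [Pi.zero_apply]
    linarith
  have := hps.dotProduct_mulVec_nonneg x.ofLp
  rw [Matrix.sub_mulVec, Matrix.smul_mulVec, Matrix.one_mulVec, jac_mulVec, dotProduct_sub,
    dotProduct_smul] at this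
  rw [← real_inner_self_eq_norm_sq, EuclideanSpace.inner_eq_star_dotProduct,
    EuclideanSpace.inner_eq_star_dotProduct]
  simpa using this

theorem mul_norm_le_norm_of_inner {x y : Eucl p} {lo : ℝ} (h : lo * ‖x‖ ^ 2 ≤ inner ℝ y x) :
    lo * ‖x‖ ≤ ‖y‖ := by
  rcases (norm_nonneg x).eq_or_lt with h0 | h0
  · rw [← h0]; simp
  · have := h.trans (real_inner_le_norm y x)
    nlinarith

/-- A map whose derivative is bounded below by `lo` is expansive with factor `lo`. -/
theorem mul_norm_sub_le {O : Set (Eucl p)} (hO : Convex ℝ O) {g : Eucl p → Eucl p}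
    (hg : ∀ x ∈ O, DifferentiableAt ℝ g x) {lo : ℝ}
    (hlo : ∀ x ∈ O, ∀ y, lo * ‖y‖ ^ 2 ≤ inner ℝ (fderiv ℝ g x y) y) {u v : Eucl p}
    (hu : u ∈ O) (hv : v ∈ O) : lo * ‖v - u‖ ≤ ‖g v - g u‖ := by
  apply mul_norm_le_norm_of_inner
  -- The mean value theorem fails for vector-valued `g`, but only the component along `v - u` is
  -- needed.
  obtain ⟨z, hz, h⟩ := domain_mvt (f := fun x => inner ℝ (v - u) (g x))
    (f' := fun x => (innerSL ℝ (v - u)).comp (fderiv ℝ g x)) (s := O)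
    (fun x hx => ((innerSL ℝ (v - u)).hasFDerivAt.comp x (hg x hx).hasFDerivAt).hasFDerivWithinAt)
    hO hu hv
  have h2 := hlo z (hO.segment_subset hu hv hz) (v - u)
  simp only [ContinuousLinearMap.comp_apply, innerSL_apply_apply] at h
  rw [real_inner_comm, inner_sub_right, h, real_inner_comm]
  exact h2

/-- First order Taylor estimate for a function with Lipschitz derivative on a convex set. -/
theorem norm_taylor_le {F : Type*} [NormedAddCommGroup F] [NormedSpace ℝ F] {O : Set (Eucl p)}
    (hO : Convex ℝ O) {g : Eucl p → F} {g' : Eucl p → Eucl p →L[ℝ] F}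
    (hg : ∀ x ∈ O, HasFDerivAt g (g' x) x) {M : ℝ}
    (hM : ∀ x ∈ O, ∀ y ∈ O, ‖g' y - g' x‖ ≤ M * ‖y - x‖) (hM0 : 0 ≤ M) {u v : Eucl p}
    (hu : u ∈ O) (hv : v ∈ O) : ‖g v - g u - g' u (v - u)‖ ≤ M * ‖v - u‖ ^ 2 := by
  have := Convex.norm_image_sub_le_of_norm_hasFDerivWithin_le' (f := g) (f' := g') (φ := g' u)
    (s := segment ℝ u v) (C := M * ‖v - u‖) (x := u) (y := v)
    (fun x hx => (hg x (hO.segment_subset hu hv hx)).hasFDerivWithinAt)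
    (fun x hx => (hM u hu x (hO.segment_subset hu hv hx)).trans
      (mul_le_mul_of_nonneg_left ?_ hM0)) (convex_segment u v) (left_mem_segment ℝ u v)
      (right_mem_segment ℝ u v)
  · calc _ ≤ _ := this
      _ = _ := by ring
  · obtain ⟨t, ht, rfl⟩ := (segment_eq_image' ℝ u v ▸ hx)
    rw [add_sub_cancel_left, norm_smul, Real.norm_of_nonneg ht.1]
    exact mul_le_of_le_one_left (norm_nonneg _) ht.2

/-- The second derivative extends continuously to a compact set and is therefore bounded; convexity
of the interior turns the bound into a Lipschitz constant. -/
theorem MemC.exists_lipschitz_fderiv {F : Type*} [NormedAddCommGroup F] [NormedSpace ℝ F]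
    {S : Set (Eucl p)} (hS : IsCompact S) (hSc : Convex ℝ S) {g : Eucl p → F}
    (hg : MemC 2 S g) : ∃ M : ℝ, 0 ≤ M ∧ ∀ x ∈ interior S, ∀ y ∈ interior S,
      ‖fderiv ℝ g y - fderiv ℝ g x‖ ≤ M * ‖y - x‖ := by
  obtain ⟨-, hd, hext⟩ := hg
  obtain ⟨k, hk, hkeq⟩ := hext 2 le_rfl
  obtain ⟨M, hM⟩ := hS.exists_bound_of_continuousOn hk
  refine ⟨max M 0, le_max_right _ _, fun x hx y hy => ?_⟩
  have hd1 : ContDiffOn ℝ 1 (fderiv ℝ g) (interior S) :=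
    hd.fderiv_of_isOpen isOpen_interior (by norm_num)
  refine Convex.norm_image_sub_le_of_norm_fderiv_le (𝕜 := ℝ) (s := interior S) (fun z hz => ?_)
    (fun z hz => ?_) hSc.interior hx hy
  · exact (hd1.differentiableOn one_ne_zero).differentiableAt (isOpen_interior.mem_nhds hz)
  · have h1 : ‖fderiv ℝ (fderiv ℝ g) z‖ = ‖iteratedFDeriv ℝ 2 g z‖ := by
      rw [← norm_iteratedFDeriv_fderiv, ← norm_iteratedFDeriv_one]
    rw [h1, ← hkeq hz]
    exact (hM z (interior_subset hz)).trans (le_max_left _ _)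

/-- A vector field with symmetric derivative on an open convex set is a gradient. -/
theorem exists_potential {O : Set (Eucl p)} (hO : Convex ℝ O) (hOo : IsOpen O)
    {h : Eucl p → Eucl p} (hd : ∀ x ∈ O, DifferentiableAt ℝ h x)
    (hs : ∀ a ∈ O, ∀ x y, inner ℝ (fderiv ℝ h a x) y = inner ℝ (fderiv ℝ h a y) x) :
    ∃ ψ : Eucl p → ℝ, ∀ a ∈ O, HasFDerivAt ψ (innerSL ℝ (h a)) a := by
  have key : ∀ a ∈ O, HasFDerivAt (fun x => innerSL ℝ (h x))
      ((innerSL ℝ : Eucl p →L[ℝ] Eucl p →L[ℝ] ℝ).comp (fderiv ℝ h a)) a := fun a ha =>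
    (innerSL ℝ : Eucl p →L[ℝ] Eucl p →L[ℝ] ℝ).hasFDerivAt.comp a (hd a ha).hasFDerivAt
  -- Poincaré lemma for the one-form `⟨h x, ·⟩`: symmetry of the derivative says that it is closed.
  refine hO.exists_forall_hasFDerivAt_of_fderiv_symmetric hOo
    (ω := fun x => innerSL ℝ (h x)) (fun a ha => (key a ha).differentiableAt.differentiableWithinAt)
    fun a ha x y => ?_
  rw [(key a ha).fderiv]
  simpa using hs a ha x y

end Analysis

/-! ### The supremum norm on structural functions -/

section Norms

variable {p : ℕ} {𝒟 : Type w₃}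

theorem abs_le_normQ [Finite 𝒟] {S : Set (Eucl p)} (hS : IsCompact S) {h : 𝒟 → Eucl p → Eucl p}
    (hc : ∀ d, ContinuousOn (h d) S) (d : 𝒟) {u : Eucl p} (hu : u ∈ S) (i : Fin p) :
    |h d u i| ≤ normQ S h := by
  have hb : BddAbove (Set.range fun v : S => |h d v i|) := by
    have hcont : ContinuousOn (fun v => |h d v i|) S :=
      (ContinuousOn.comp (t := Set.univ) (g := fun x : Eucl p => x i) (by fun_prop) (hc d)
        fun _ _ => trivial).abs
    have := (hS.image_of_continuousOn hcont).bddAbove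
    rwa [Set.image_eq_range] at this
  calc |h d u i| ≤ ⨆ v : S, |h d v i| := le_ciSup hb ⟨u, hu⟩
    _ ≤ supNorm S (h d) :=
      le_ciSup (f := fun i => ⨆ v : S, |h d v i|) (Set.finite_range _).bddAbove i
    _ ≤ _ := le_ciSup (f := fun d => supNorm S (h d)) (Set.finite_range _).bddAbove d

/-- A real supremum over an empty index is `0`, which `0 ≤ c` excludes. -/
theorem exists_lt_of_lt_iSup_real {ι : Sort*} {F : ι → ℝ} {c : ℝ} (hc : 0 ≤ c)
    (hF : c < ⨆ j, F j) : ∃ j, c < F j := by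
  rcases isEmpty_or_nonempty ι with _ | _
  · rw [Real.iSup_of_isEmpty] at hF; linarith
  · exact exists_lt_of_lt_ciSup hF

theorem exists_lt_of_lt_normQ {S : Set (Eucl p)} {h : 𝒟 → Eucl p → Eucl p} {c : ℝ} (hc : 0 ≤ c)
    (hlt : c < normQ S h) : ∃ d i, ∃ u ∈ S, c < |h d u i| := by
  obtain ⟨d, hd⟩ := exists_lt_of_lt_iSup_real hc hlt
  obtain ⟨i, hi⟩ := exists_lt_of_lt_iSup_real hc hd
  obtain ⟨u, hu⟩ := exists_lt_of_lt_iSup_real hc hi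
  exact ⟨d, i, u, u.2, hu⟩

theorem normQ_eq_mul {S : Set (Eucl p)} {h k : 𝒟 → Eucl p → Eucl p} {a : ℝ} (ha : 0 ≤ a)
    (hk : ∀ d, ∀ u ∈ S, k d u = a • h d u) : normQ S k = a * normQ S h := by
  simp only [normQ, supNorm, Real.mul_iSup_of_nonneg ha]
  refine iSup_congr fun d => iSup_congr fun i => iSup_congr fun u => ?_
  simp [hk d u u.2, abs_mul, abs_of_nonneg ha]

theorem norm_le_of_abs_le {x : Eucl p} {c : ℝ} (h : ∀ i, |x i| ≤ c) : ‖x‖ ≤ p * c := by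
  have hx : x = ∑ j, x j • EuclideanSpace.single j (1 : ℝ) := by
    ext k
    simp [Finset.sum_apply, Pi.single_apply]
  rw [hx]
  refine (norm_sum_le _ _).trans ?_
  calc _ ≤ ∑ _j : Fin p, c := Finset.sum_le_sum fun j _ => by simpa [norm_smul] using h j
    _ = _ := by simp

end Norms

/-! ### Second-order expansion of the potentials -/

section Expansion

variable {p : ℕ}

/-- Second order expansion of a potential `ψ` along the perturbation of a structural function `g`
into `q = g + a k`. -/
theorem abs_expansion_le {O : Set (Eucl p)} (hO : Convex ℝ O) {g q k k' : Eucl p → Eucl p}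
    {ψ : Eucl p → ℝ} {lo K M H a : ℝ} (hlo : 0 < lo) (hK : 0 ≤ K) (hM : 0 ≤ M) (hH : 0 ≤ H)
    (ha : 0 ≤ a) (hg : ∀ x ∈ O, DifferentiableAt ℝ g x)
    (hgM : ∀ x ∈ O, ∀ y ∈ O, ‖fderiv ℝ g y - fderiv ℝ g x‖ ≤ M * ‖y - x‖)
    (hglo : ∀ x ∈ O, ∀ y, lo * ‖y‖ ≤ ‖fderiv ℝ g x y‖)
    (hqlo : ∀ x ∈ O, ∀ y ∈ O, lo * ‖y - x‖ ≤ ‖q y - q x‖)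
    (hq : ∀ x ∈ O, q x = g x + a • k x)
    (hkH : ∀ x ∈ O, ‖k x‖ ≤ H) (hkK : ∀ x ∈ O, ∀ y ∈ O, ‖k y - k x‖ ≤ K * ‖y - x‖)
    (hkH' : ∀ x ∈ O, ‖k' x‖ ≤ H) (hkK' : ∀ x ∈ O, ∀ y ∈ O, ‖k' y - k' x‖ ≤ K * ‖y - x‖)
    (hψ : ∀ x ∈ O, HasFDerivAt ψ (innerSL ℝ (k' x)) x)
    {u v w : Eucl p} (hu : u ∈ O) (hv : v ∈ O) (huv : q v = g u) (hw : fderiv ℝ g u w = k u) :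
    |ψ v - ψ u + a * inner ℝ (k' u) w| ≤
      (K * (H / lo) ^ 2 + H * ((M * (H / lo) ^ 2 + K * (H / lo)) / lo)) * a ^ 2 := by
  -- Since `q v = g u`, the increment `q v - q u` equals `-a • k u`, and expansiveness of `q` makes
  -- `v - u` of order `a`.
  have hn : ‖v - u‖ ≤ a * (H / lo) := by
    have h1 := hqlo u hu v hv
    have h2 : q v - q u = -(a • k u) := by rw [huv, hq u hu]; abel
    rw [h2, norm_neg, norm_smul, Real.norm_of_nonneg ha] at h1
    have h3 : a * ‖k u‖ ≤ a * H := mul_le_mul_of_nonneg_left (hkH u hu) ha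
    rw [← mul_div_assoc, le_div_iff₀ hlo]
    linarith
  have hn2 : ‖v - u‖ ^ 2 ≤ (H / lo) ^ 2 * a ^ 2 := by
    calc ‖v - u‖ ^ 2 ≤ (a * (H / lo)) ^ 2 := by gcongr
      _ = _ := by ring
  have hT : |ψ v - ψ u - inner ℝ (k' u) (v - u)| ≤ K * ‖v - u‖ ^ 2 := by
    have := norm_taylor_le hO hψ (M := K) (fun x hx y hy => by
      rw [← map_sub, innerSL_apply_norm]
      exact hkK' x hx y hy) hK hu hv
    simpa using this
  -- The derivative of `g` sends `v - u + a • w` to the Taylor remainder of `g` and `a • (k v - k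
  -- u)`, up to sign; both are of order `a ^ 2`.
  have he : lo * ‖v - u + a • w‖ ≤ (M * (H / lo) ^ 2 + K * (H / lo)) * a ^ 2 := by
    refine (hglo u hu _).trans ?_
    have h1 : fderiv ℝ g u (v - u + a • w) =
        -(g v - g u - fderiv ℝ g u (v - u)) - a • (k v - k u) := by
      have h2 : g v = g u - a • k v := by rw [← huv, hq v hv]; abel
      rw [map_add, map_smul, hw, h2, smul_sub]
      abel
    rw [h1]
    refine (norm_sub_le _ _).trans ?_
    rw [norm_neg, norm_smul, Real.norm_of_nonneg ha]
    have h2 := norm_taylor_le hO (fun x hx => (hg x hx).hasFDerivAt) hgM hM hu hv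
    have h3 : a * ‖k v - k u‖ ≤ a * (K * (a * (H / lo))) :=
      mul_le_mul_of_nonneg_left ((hkK u hu v hv).trans (mul_le_mul_of_nonneg_left hn hK)) ha
    have h4 := mul_le_mul_of_nonneg_left hn2 hM
    linarith
  have he' : ‖v - u + a • w‖ ≤ (M * (H / lo) ^ 2 + K * (H / lo)) / lo * a ^ 2 := by
    rw [div_mul_eq_mul_div, le_div_iff₀ hlo]
    linarith
  have hi : |inner ℝ (k' u) (v - u + a • w)| ≤
      H * ((M * (H / lo) ^ 2 + K * (H / lo)) / lo * a ^ 2) :=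
    (abs_real_inner_le_norm _ _).trans
      (mul_le_mul (hkH' u hu) he' (norm_nonneg _) hH)
  have hsplit : ψ v - ψ u + a * inner ℝ (k' u) w =
      (ψ v - ψ u - inner ℝ (k' u) (v - u)) + inner ℝ (k' u) (v - u + a • w) := by
    rw [inner_add_right, inner_smul_right]; ring
  rw [hsplit]
  refine (abs_add_le _ _).trans ?_
  have h4 := mul_le_mul_of_nonneg_left hn2 hK
  linarith

end Expansion

/-! ### Ranks of the observed outcome -/

section Model

variable {p : ℕ} {𝒟 : Type w₃} {𝒵 : Type w₄} [MeasurableSpace 𝒟] [MeasurableSpace 𝒵]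

theorem measurable_comp_index {Ω F : Type*} [MeasurableSpace Ω] [MeasurableSpace F] [Countable 𝒟]
    [DiscreteMeasurableSpace 𝒟] {X : 𝒟 → Ω → F} (hX : ∀ d, Measurable (X d)) {D : Ω → 𝒟}
    (hD : Measurable D) : Measurable fun ω => X (D ω) ω := by
  have : Measurable fun x : 𝒟 × Ω => X x.1 x.2 := measurable_from_prod_countable_right hX
  exact this.comp (hD.prodMk measurable_id)

namespace IsModel

variable {𝒰 : Set (Eucl p)} {μ : Measure (Eucl p)} {Ω : Type*} [MeasurableSpace Ω] {P : Measure Ω}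
  {N : Type*} [MeasurableSpace N] {Y : 𝒟 → Ω → Eucl p} {D : Ω → 𝒟}
  {Z : Ω → 𝒵} {U : 𝒟 → Ω → Eucl p} {ν : Ω → N} {q : 𝒟 → Eucl p → Eucl p}

/-- By the selection equation the event on `D` and `Z` is, up to a null set, measurable with respect
to `(Z, ν)`. Both probabilities are then integrals over it of conditional probabilities, which agree
by rank similarity. -/
theorem measure_rank_inter [IsProbabilityMeasure P] (h : IsModel 𝒰 μ P Y D Z U ν q)
    [DiscreteMeasurableSpace 𝒟]
    (d d' e : 𝒟) {B : Set (Eucl p)} (hB : MeasurableSet B) {C : Set 𝒵} (hC : MeasurableSet C) :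
    P (U d ⁻¹' B ∩ (D ⁻¹' {e} ∩ Z ⁻¹' C)) = P (U d' ⁻¹' B ∩ (D ⁻¹' {e} ∩ Z ⁻¹' C)) := by
  obtain ⟨δ, hδ, hD⟩ := h.selection
  set ζ : Ω → 𝒵 × N := fun ω => (Z ω, ν ω) with hζ
  have hζm : Measurable ζ := h.measurable_Z.prodMk h.measurable_ν
  have hle : MeasurableSpace.comap ζ inferInstance ≤ ‹MeasurableSpace Ω› := hζm.comap_le
  set E : Set Ω := ζ ⁻¹' (δ ⁻¹' {e} ∩ Prod.fst ⁻¹' C) with hE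
  have hEm : MeasurableSet[MeasurableSpace.comap ζ inferInstance] E :=
    ⟨_, (hδ (measurableSet_singleton e)).inter (measurable_fst hC), rfl⟩
  have hae : (D ⁻¹' {e} ∩ Z ⁻¹' C : Set Ω) =ᵐ[P] E := by
    filter_upwards [hD] with ω hω
    apply propext
    change (D ω = e ∧ Z ω ∈ C) ↔ (δ (Z ω, ν ω) = e ∧ Z ω ∈ C)
    rw [hω]
  have key : ∀ c : 𝒟, P (U c ⁻¹' B ∩ (D ⁻¹' {e} ∩ Z ⁻¹' C)) = ENNReal.ofReal
      (∫ ω in E, (P⟦U c ⁻¹' B | MeasurableSpace.comap ζ inferInstance⟧) ω ∂P) := by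
    intro c
    rw [setIntegral_condExp hle _ hEm]
    · rw [integral_indicator (h.measurable_U c hB), setIntegral_const, smul_eq_mul, mul_one,
        measureReal_restrict_apply (h.measurable_U c hB), ofReal_measureReal]
      exact measure_congr ((ae_eq_refl _).inter hae)
    · exact (integrable_const _).indicator (h.measurable_U c hB)
  rw [key d, key d']
  congr 1
  exact integral_congr_ae (ae_restrict_of_ae (h.rank_similarity d d' B hB))

/-- The rank of the observed outcome is independent of the instrument, with law `μ`. -/
theorem map_observed_rank [IsProbabilityMeasure P] (h : IsModel 𝒰 μ P Y D Z U ν q)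
    [DiscreteMeasurableSpace 𝒟] [Fintype 𝒟] [IsProbabilityMeasure μ] :
    P.map (fun ω => (U (D ω) ω, Z ω)) = μ.prod (P.map Z) := by
  have hm : Measurable fun ω => (U (D ω) ω, Z ω) :=
    (measurable_comp_index h.measurable_U h.measurable_D).prodMk h.measurable_Z
  have : IsProbabilityMeasure (P.map Z) :=
    Measure.isProbabilityMeasure_map h.measurable_Z.aemeasurable
  symm
  refine Measure.prod_eq fun B C hB hC => ?_
  rw [Measure.map_apply hm (hB.prod hC), Measure.map_apply h.measurable_Z hC]
  have hsum : ∀ A : Set Ω, MeasurableSet A → P A = ∑ d, P (A ∩ D ⁻¹' {d}) := by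
    intro A hA
    rw [← measure_biUnion_finset]
    · congr 1
      ext ω
      simp
    · intro d _ d' _ hdd
      refine Set.disjoint_left.2 fun ω h1 h2 => hdd ?_
      rw [← h1.2, ← h2.2]
    · exact fun d _ => hA.inter (h.measurable_D (measurableSet_singleton d))
  -- Any fixed treatment serves as reference; `D ω₀` supplies one. On each slice `D = d` the rank `U
  -- d` is exchanged for the reference rank, which is independent of `Z`.
  obtain ⟨ω₀⟩ := P.nonempty_of_neZero
  have hBC : (fun ω => (U (D ω) ω, Z ω)) ⁻¹' (B ×ˢ C) =
      (fun ω => U (D ω) ω) ⁻¹' B ∩ Z ⁻¹' C := rfl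
  have hZC := h.measurable_Z hC
  rw [hBC, hsum _ ((measurable_comp_index h.measurable_U h.measurable_D hB).inter hZC),
    ← h.law_U (D ω₀), Measure.map_apply (h.measurable_U _) hB,
    ← (h.indep (D ω₀)).measure_inter_preimage_eq_mul B C hB hC,
    hsum _ ((h.measurable_U _ hB).inter hZC)]
  refine Finset.sum_congr rfl fun d _ => ?_
  have h1 : (fun ω => U (D ω) ω) ⁻¹' B ∩ Z ⁻¹' C ∩ D ⁻¹' {d} =
      U d ⁻¹' B ∩ (D ⁻¹' {d} ∩ Z ⁻¹' C) := by
    ext ω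
    simp only [Set.mem_inter_iff, Set.mem_preimage, Set.mem_singleton_iff]
    constructor
    · rintro ⟨⟨h1, h2⟩, rfl⟩; exact ⟨h1, rfl, h2⟩
    · rintro ⟨h1, rfl, h2⟩; exact ⟨⟨h1, h2⟩, rfl⟩
  rw [h1, h.measure_rank_inter d (D ω₀) d hB hC]
  congr 1
  ext ω
  simp only [Set.mem_inter_iff, Set.mem_preimage, Set.mem_singleton_iff]
  tauto

theorem ae_rank_mem (h : IsModel 𝒰 μ P Y D Z U ν q) {O : Set (Eucl p)} (hO : MeasurableSet O)
    (hμ : μ Oᶜ = 0) (d : 𝒟) : ∀ᵐ ω ∂P, U d ω ∈ O := by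
  rw [← h.law_U d, Measure.map_apply (h.measurable_U d) hO.compl] at hμ
  exact hμ

theorem ae_observed_eq (h : IsModel 𝒰 μ P Y D Z U ν q) [Countable 𝒟] {O : Set (Eucl p)}
    (hO : MeasurableSet O) (hμ : μ Oᶜ = 0) :
    ∀ᵐ ω ∂P, U (D ω) ω ∈ O ∧ observed Y D ω = q (D ω) (U (D ω) ω) := by
  filter_upwards [ae_all_iff.2 (h.ae_rank_mem hO hμ), ae_all_iff.2 h.structural] with ω h1 h2
  exact ⟨h1 _, h2 _⟩

end IsModel

/-- A continuous injection on a Borel set is a measurable embedding (Lusin–Souslin), so its inverse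
extends measurably from the image. -/
theorem exists_measurable_leftInverse {O : Set (Eucl p)} (hO : MeasurableSet O)
    {g : Eucl p → Eucl p} (hg : ContinuousOn g O) (hi : Set.InjOn g O) :
    ∃ r : Eucl p → Eucl p, Measurable r ∧ ∀ u ∈ O, r (g u) = u := by
  obtain ⟨r, hr, hrg⟩ := (hg.measurableEmbedding hO hi).exists_measurable_extend
    (measurable_subtype_coe (p := (· ∈ O))) fun _ => ⟨0⟩
  exact ⟨r, hr, fun u hu => congrFun hrg ⟨u, hu⟩⟩

theorem measurable_piecewise_zero {F : Type*} [TopologicalSpace F] [MeasurableSpace F]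
    [BorelSpace F] [Zero F] {O : Set (Eucl p)} (hO : MeasurableSet O) {g : Eucl p → F}
    (hg : ContinuousOn g O) : Measurable (O.indicator g) := by
  classical
  rw [← Set.piecewise_eq_indicator]
  exact hg.measurable_piecewise continuousOn_const hO

/-- If two models induce the same distribution of the observables, the ranks implied by the second
structural function can be reconstructed on the probability space of the first model. -/
theorem exists_reconstructed_rank [Fintype 𝒟] [DiscreteMeasurableSpace 𝒟]
    {𝒰 : Set (Eucl p)} {μ : Measure (Eucl p)} [IsProbabilityMeasure μ]
    {Ω : Type*} [MeasurableSpace Ω] {P : Measure Ω} [IsProbabilityMeasure P] {Y : 𝒟 → Ω → Eucl p}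
    {D : Ω → 𝒟} {Z : Ω → 𝒵} (hY : ∀ d, Measurable (Y d)) (hD : Measurable D) (hZ : Measurable Z)
    {Ω' : Type*} [MeasurableSpace Ω'] {P' : Measure Ω'} [IsProbabilityMeasure P']
    {N' : Type*} [MeasurableSpace N'] {Y' : 𝒟 → Ω' → Eucl p} {D' : Ω' → 𝒟} {Z' : Ω' → 𝒵}
    {U' : 𝒟 → Ω' → Eucl p} {ν' : Ω' → N'} {q : 𝒟 → Eucl p → Eucl p}
    (h' : IsModel 𝒰 μ P' Y' D' Z' U' ν' q) (hlaw : observedLaw P' Y' D' Z' = observedLaw P Y D Z)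
    {O : Set (Eucl p)} (hO : MeasurableSet O) (hμO : μ Oᶜ = 0)
    (hq : ∀ d, ContinuousOn (q d) O) (hi : ∀ d, Set.InjOn (q d) O) :
    ∃ V : Ω → Eucl p, Measurable V ∧
      (∀ᵐ ω ∂P, V ω ∈ O ∧ q (D ω) (V ω) = observed Y D ω) ∧
      P.map (fun ω => (V ω, Z ω)) = μ.prod (P.map Z) := by
  choose r hr hrq using fun d => exists_measurable_leftInverse hO (hq d) (hi d)
  have hobs : Measurable fun ω => (observed Y D ω, D ω, Z ω) :=
    (measurable_comp_index hY hD).prodMk (hD.prodMk hZ)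
  have hobs' : Measurable fun ω => (observed Y' D' ω, D' ω, Z' ω) :=
    (measurable_comp_index h'.measurable_Y h'.measurable_D).prodMk
      (h'.measurable_D.prodMk h'.measurable_Z)
  have hR : Measurable fun x : Eucl p × 𝒟 × 𝒵 => r x.2.1 x.1 := by
    have : Measurable fun x : 𝒟 × Eucl p => r x.1 x.2 := measurable_from_prod_countable_right hr
    exact this.comp ((measurable_fst.comp measurable_snd).prodMk measurable_fst)
  have hQ : Measurable fun x : Eucl p × 𝒟 × 𝒵 => O.indicator (q x.2.1) (r x.2.1 x.1) := by
    have : Measurable fun x : 𝒟 × Eucl p => O.indicator (q x.1) x.2 :=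
      measurable_from_prod_countable_right fun d => measurable_piecewise_zero hO (hq d)
    exact this.comp ((measurable_fst.comp measurable_snd).prodMk hR)
  -- The event that the outcome is `q` of its reconstructed rank. It involves only the observables,
  -- so its full measure passes from the second model to the first.
  set S : Set (Eucl p × 𝒟 × 𝒵) :=
    {x | r x.2.1 x.1 ∈ O ∧ O.indicator (q x.2.1) (r x.2.1 x.1) = x.1}
  have hS : MeasurableSet S := (hR hO).inter (measurableSet_eq_fun hQ measurable_fst)
  have hae' := h'.ae_observed_eq hO hμO
  have hSL : ∀ᵐ x ∂observedLaw P' Y' D' Z', x ∈ S := by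
    rw [observedLaw, ae_map_iff (p := (· ∈ S)) hobs'.aemeasurable hS]
    filter_upwards [hae'] with ω hω
    have h1 : r (D' ω) (observed Y' D' ω) = U' (D' ω) ω := by
      rw [hω.2, hrq _ _ hω.1]
    refine ⟨by simpa [h1] using hω.1, ?_⟩
    simp only [h1]
    rw [Set.indicator_of_mem hω.1, hω.2]
  rw [hlaw, observedLaw, ae_map_iff (p := (· ∈ S)) hobs.aemeasurable hS] at hSL
  refine ⟨fun ω => r (D ω) (observed Y D ω), hR.comp hobs, ?_, ?_⟩
  · filter_upwards [hSL] with ω hω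
    refine ⟨hω.1, ?_⟩
    have := hω.2
    rwa [Set.indicator_of_mem hω.1] at this
  · have hRZ : Measurable fun x : Eucl p × 𝒟 × 𝒵 => (r x.2.1 x.1, x.2.2) :=
      hR.prodMk (measurable_snd.comp measurable_snd)
    have e1 : P.map (fun ω => (r (D ω) (observed Y D ω), Z ω)) =
        (observedLaw P Y D Z).map fun x => (r x.2.1 x.1, x.2.2) := by
      rw [observedLaw, Measure.map_map hRZ hobs]; rfl
    have e2 : (observedLaw P' Y' D' Z').map (fun x => (r x.2.1 x.1, x.2.2)) =
        P'.map fun ω => (U' (D' ω) ω, Z' ω) := by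
      rw [observedLaw, Measure.map_map hRZ hobs']
      refine Measure.map_congr ?_
      filter_upwards [hae'] with ω hω
      simp [hω.2, hrq _ _ hω.1]
    have hZL : Measurable fun x : Eucl p × 𝒟 × 𝒵 => x.2.2 := measurable_snd.comp measurable_snd
    have e3 : P'.map Z' = P.map Z := by
      have : (observedLaw P' Y' D' Z').map (fun x => x.2.2) =
          (observedLaw P Y D Z).map (fun x => x.2.2) := by rw [hlaw]
      rw [observedLaw, observedLaw, Measure.map_map hZL hobs, Measure.map_map hZL hobs'] at this
      exact this
    rw [e1, ← hlaw, e2, h'.map_observed_rank, e3]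

end Model
-- Uniform lower bound for the integrated form
section LowerBound

variable {p : ℕ} {𝒟 : Type w₃} [Fintype 𝒟]

theorem exists_pos_mul_sq_norm_le {Q : (𝒟 → Fin p → ℝ) → ℝ} (hc : Continuous Q)
    (hh : ∀ (t : ℝ) ξ, Q (t • ξ) = t ^ 2 * Q ξ) (hpos : ∀ ξ, ξ ≠ 0 → 0 < Q ξ) :
    ∃ c : ℝ, 0 < c ∧ ∀ ξ, c * ‖ξ‖ ^ 2 ≤ Q ξ := by
  have hQ0 : Q 0 = 0 := by simpa using hh 0 0
  rcases (Metric.sphere (0 : 𝒟 → Fin p → ℝ) 1).eq_empty_or_nonempty with he | hne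
  · refine ⟨1, one_pos, fun ξ => ?_⟩
    have : ξ = 0 := by
      by_contra h0
      have : (‖ξ‖⁻¹ • ξ) ∈ Metric.sphere (0 : 𝒟 → Fin p → ℝ) 1 := by
        simp [norm_smul, h0]
      rw [he] at this
      exact this
    simp [this, hQ0]
  · obtain ⟨ζ, hζ, hmin⟩ := (isCompact_sphere (0 : 𝒟 → Fin p → ℝ) 1).exists_isMinOn hne
      hc.continuousOn
    refine ⟨Q ζ, hpos ζ (Metric.ne_of_mem_sphere hζ one_ne_zero), fun ξ => ?_⟩
    by_cases h0 : ξ = 0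
    · simp [h0, hQ0]
    · have h1 : (‖ξ‖⁻¹ • ξ) ∈ Metric.sphere (0 : 𝒟 → Fin p → ℝ) 1 := by
        simp [norm_smul, h0]
      have h2 : Q ζ ≤ Q (‖ξ‖⁻¹ • ξ) := hmin h1
      have h3 : Q ξ = ‖ξ‖ ^ 2 * Q (‖ξ‖⁻¹ • ξ) := by
        rw [← hh, smul_smul, mul_inv_cancel₀ (norm_ne_zero_iff.2 h0), one_smul]
      rw [h3, mul_comm]
      gcongr

/-- Near a given `x`, some `A n` charges the ball of radius `r / 2`, which lies in the `r`-ball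
around every point within `r / 2` of `x`. Compactness leaves finitely many `n`, and monotonicity
allows taking their maximum. -/
theorem exists_uniform_measure_lower_bound {τ : Measure (Eucl p)} {S : Set (Eucl p)}
    (hS : IsCompact S) (hτ : ∀ x ∈ S, ∀ r > 0, 0 < τ (Metric.ball x r)) {A : ℕ → Set (Eucl p)}
    (hA : Monotone A) (hAτ : ∀ᵐ u ∂τ, ∃ n, u ∈ A n) {r : ℝ} (hr : 0 < r) :
    ∃ (n : ℕ) (η : ENNReal), 0 < η ∧ ∀ x ∈ S, η ≤ τ (A n ∩ Metric.ball x r) := by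
  refine hS.induction_on (p := fun T => ∃ (n : ℕ) (η : ENNReal), 0 < η ∧
    ∀ x ∈ T, η ≤ τ (A n ∩ Metric.ball x r)) ⟨0, 1, one_pos, by simp⟩ ?_ ?_ ?_
  · rintro T T' hTT' ⟨n, η, hη, h⟩
    exact ⟨n, η, hη, fun x hx => h x (hTT' hx)⟩
  · rintro T T' ⟨n, η, hη, h⟩ ⟨n', η', hη', h'⟩
    refine ⟨max n n', min η η', lt_min hη hη', ?_⟩
    rintro x (hx | hx)
    · exact (min_le_left _ _).trans ((h x hx).trans
        (measure_mono (Set.inter_subset_inter_left _ (hA (le_max_left _ _)))))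
    · exact (min_le_right _ _).trans ((h' x hx).trans
        (measure_mono (Set.inter_subset_inter_left _ (hA (le_max_right _ _)))))
  · intro x hx
    have hu : 0 < τ (⋃ n, A n ∩ Metric.ball x (r / 2)) := by
      refine (hτ x hx (r / 2) (by positivity)).trans_le (measure_mono_ae ?_)
      filter_upwards [hAτ] with u ⟨n, hn⟩ hu
      exact Set.mem_iUnion.2 ⟨n, hn, hu⟩
    obtain ⟨n, hn⟩ : ∃ n, 0 < τ (A n ∩ Metric.ball x (r / 2)) := by
      by_contra hcon
      push Not at hcon
      exact hu.ne' (measure_iUnion_null fun n => le_antisymm (hcon n) bot_le)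
    refine ⟨S ∩ Metric.ball x (r / 2), Filter.inter_mem self_mem_nhdsWithin
      (mem_nhdsWithin_of_mem_nhds (Metric.ball_mem_nhds x (by positivity))), n, _, hn, ?_⟩
    intro y hy
    refine measure_mono (Set.inter_subset_inter_right _ (Metric.ball_subset_ball' ?_))
    have := Metric.mem_ball'.1 hy.2
    linarith

/-- An almost everywhere positive definite form, integrated along `K`-Lipschitz families of vector
fields of norm one, is bounded away from zero. -/
theorem exists_pos_le_integral_form {τ : Measure (Eucl p)} [IsFiniteMeasure τ]
    {S : Set (Eucl p)} (hS : IsCompact S) (hτS : ∀ᵐ u ∂τ, u ∈ S)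
    (hτ : ∀ x ∈ S, ∀ r > 0, 0 < τ (Metric.ball x r))
    {Q : Eucl p → (𝒟 → Fin p → ℝ) → ℝ} (hc : ∀ u, Continuous (Q u))
    (hh : ∀ u (t : ℝ) ξ, Q u (t • ξ) = t ^ 2 * Q u ξ)
    (hpos : ∀ᵐ u ∂τ, ∀ ξ, ξ ≠ 0 → 0 < Q u ξ) {K : ℝ} (hK : 0 < K) :
    ∃ c : ℝ, 0 < c ∧ ∀ h : 𝒟 → Eucl p → Eucl p, normQ S h = 1 →
      (∀ d, ∀ x ∈ S, ∀ y ∈ S, ‖h d y - h d x‖ ≤ K * ‖y - x‖) →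
      Integrable (fun u => Q u fun d => (h d u).ofLp) τ →
      c ≤ ∫ u, Q u (fun d => (h d u).ofLp) ∂τ := by
  -- On `A n` the form dominates `‖ξ‖ ^ 2 / (n + 1)`. Within the radius `1 / (4 * K)` a coordinate
  -- of `h` exceeding `1 / 2` in absolute value at the centre stays at least `1 / 4`.
  obtain ⟨n, η, hη, hn⟩ := exists_uniform_measure_lower_bound hS hτ
    (A := fun n : ℕ => {u | u ∈ S ∧ ∀ ξ, ((n : ℝ) + 1)⁻¹ * ‖ξ‖ ^ 2 ≤ Q u ξ})
    (fun n m hnm u hu => ⟨hu.1, fun ξ => le_trans (by gcongr) (hu.2 ξ)⟩)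
    (by
      filter_upwards [hpos, hτS] with u hu huS
      obtain ⟨c, hc0, hcQ⟩ := exists_pos_mul_sq_norm_le (hc u) (hh u) hu
      obtain ⟨n, hn⟩ := exists_nat_one_div_lt hc0
      rw [one_div] at hn
      exact ⟨n, huS, fun ξ => le_trans (by gcongr) (hcQ ξ)⟩)
    (r := 1 / (4 * K)) (by positivity)
  rcases S.eq_empty_or_nonempty with rfl | ⟨x₀, hx₀⟩
  · refine ⟨1, one_pos, fun h h1 => ?_⟩
    obtain ⟨d, i, u, hu, -⟩ := exists_lt_of_lt_normQ (c := 1 / 2) (by norm_num)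
      (by rw [h1]; norm_num : (1 / 2 : ℝ) < normQ ∅ h)
    exact hu.elim
  have hηtop : η ≠ ⊤ := ne_top_of_le_ne_top (measure_ne_top τ _) (hn x₀ hx₀)
  refine ⟨((n : ℝ) + 1)⁻¹ * (1 / 4) ^ 2 * η.toReal,
    mul_pos (by positivity) (ENNReal.toReal_pos hη.ne' hηtop), fun h h1 hL hint => ?_⟩
  obtain ⟨d, i, u₀, hu₀, hlt⟩ := exists_lt_of_lt_normQ (c := 1 / 2) (by norm_num)
    (by rw [h1]; norm_num : (1 / 2 : ℝ) < normQ S h)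
  have hnn : 0 ≤ᵐ[τ] fun u => Q u fun d => (h d u).ofLp := by
    filter_upwards [hpos] with u hu
    by_cases h0 : (fun d => (h d u).ofLp) = 0
    · have := hh u 0 0
      simp only [Pi.zero_apply]
      rw [h0]
      simp only [smul_zero] at this
      linarith
    · exact (hu _ h0).le
  refine le_trans ?_ (mul_meas_ge_le_integral_of_nonneg hnn hint (((n : ℝ) + 1)⁻¹ * (1 / 4) ^ 2))
  refine mul_le_mul_of_nonneg_left ?_ (by positivity)
  refine ENNReal.toReal_mono (measure_ne_top _ _) ((hn u₀ hu₀).trans (measure_mono ?_))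
  rintro u ⟨⟨huS, hu⟩, hub⟩
  refine le_trans ?_ (hu _)
  have h3 : (1 / 4 : ℝ) ≤ ‖fun d => (h d u).ofLp‖ := by
    have h4 : |h d u i| ≤ ‖fun d => (h d u).ofLp‖ :=
      (norm_le_pi_norm (h d u).ofLp i).trans (norm_le_pi_norm (fun d => (h d u).ofLp) d)
    have h5 : |h d u i - h d u₀ i| ≤ 1 / 4 := by
      have h6 := (PiLp.norm_apply_le (h d u - h d u₀) i).trans (hL d u₀ hu₀ u huS)
      rw [Metric.mem_ball, dist_eq_norm, lt_div_iff₀ (by positivity)] at hub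
      rw [PiLp.sub_apply, Real.norm_eq_abs] at h6
      linarith
    have h7 := abs_sub_abs_le_abs_sub (h d u₀ i) (h d u i)
    rw [abs_sub_comm] at h7
    linarith
  gcongr

end LowerBound

/-! ### Densities of the ranks -/

section Density

variable {p : ℕ} {𝒟 : Type w₃} {𝒵 : Type w₄} [MeasurableSpace 𝒟] [MeasurableSpace 𝒵]

/-- An absolutely continuous measure is equivalent to the restriction of Lebesgue measure to the set
where its density is nonzero. -/
theorem exists_equivalent_restrict {μ : Measure (Eucl p)} [SigmaFinite μ] (hμ : μ ≪ volume)
    {O : Set (Eucl p)} (hO : MeasurableSet O) (hμO : μ Oᶜ = 0) :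
    ∃ T ⊆ O, MeasurableSet T ∧ μ ≪ volume.restrict T ∧ volume.restrict T ≪ μ := by
  have hw : Measurable (μ.rnDeriv volume) := Measure.measurable_rnDeriv _ _
  have hμw : volume.withDensity (μ.rnDeriv volume) = μ := Measure.withDensity_rnDeriv_eq _ _ hμ
  have hS : MeasurableSet {u | μ.rnDeriv volume u ≠ 0} := (hw (measurableSet_singleton 0)).compl
  refine ⟨O ∩ {u | μ.rnDeriv volume u ≠ 0}, Set.inter_subset_left, hO.inter hS, ?_, ?_⟩
  · refine Measure.AbsolutelyContinuous.mk fun A hA h0 => ?_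
    rw [Measure.restrict_apply hA] at h0
    have h1 : volume.withDensity (μ.rnDeriv volume) {u | μ.rnDeriv volume u ≠ 0}ᶜ = 0 := by
      rw [withDensity_apply _ hS.compl, setLIntegral_eq_zero_iff hS.compl hw]
      exact Filter.Eventually.of_forall fun u hu => by simpa using hu
    rw [hμw] at h1
    refine measure_mono_null (t := A ∩ (O ∩ {u | μ.rnDeriv volume u ≠ 0}) ∪
      (Oᶜ ∪ {u | μ.rnDeriv volume u ≠ 0}ᶜ)) (fun u hu => ?_)
      (measure_union_null (hμ h0) (measure_union_null hμO h1))
    by_cases h2 : u ∈ O ∩ {u | μ.rnDeriv volume u ≠ 0}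
    · exact Or.inl ⟨hu, h2⟩
    · rw [← Set.compl_inter]; exact Or.inr h2
  · have h1 : volume.restrict (O ∩ {u | μ.rnDeriv volume u ≠ 0}) ≪
        (volume.restrict (O ∩ {u | μ.rnDeriv volume u ≠ 0})).withDensity (μ.rnDeriv volume) :=
      withDensity_absolutelyContinuous' hw.aemeasurable
        ((ae_restrict_iff' (hO.inter hS)).2 (Filter.Eventually.of_forall fun u hu => hu.2))
    rw [← restrict_withDensity (hO.inter hS), hμw] at h1
    exact h1.trans Measure.restrict_le_self.absolutelyContinuous

/-- Law of the rank `U_d` on the event `D = d`, conditionally on `Z = z`. -/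
noncomputable def rankLaw {Ω : Type*} [MeasurableSpace Ω] (P : Measure Ω) (D : Ω → 𝒟) (Z : Ω → 𝒵)
    (U : 𝒟 → Ω → Eucl p) (d : 𝒟) (z : 𝒵) : Measure (Eucl p) :=
  ((P[|Z ⁻¹' {z}]).restrict (D ⁻¹' {d})).map (U d)

variable {𝒰 : Set (Eucl p)} {μ : Measure (Eucl p)} {Ω : Type*} [MeasurableSpace Ω] {P : Measure Ω}
  {N : Type*} [MeasurableSpace N] {Y : 𝒟 → Ω → Eucl p} {D : Ω → 𝒟}
  {Z : Ω → 𝒵} {U : 𝒟 → Ω → Eucl p} {ν : Ω → N} {q : 𝒟 → Eucl p → Eucl p}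

theorem IsModel.mem_outcomeSupport (h : IsModel 𝒰 μ P Y D Z U ν q) {O : Set (Eucl p)}
    (hO : IsOpen O) (hμ : O ⊆ μ.support) (d : 𝒟) (hq : ContinuousOn (q d) O) {u : Eucl p}
    (hu : u ∈ O) : q d u ∈ outcomeSupport P Y d := by
  rw [outcomeSupport, Measure.mem_support_iff_forall]
  intro A hA
  obtain ⟨C, hCA, hCo, huC⟩ := mem_nhds_iff.1 ((hq.continuousAt (hO.mem_nhds hu)).preimage_mem_nhds
    (isOpen_interior.mem_nhds (mem_interior_iff_mem_nhds.2 hA)))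
  have h2 := (Measure.mem_support_iff_forall u).1 (hμ hu) _ (hCo.mem_nhds huC)
  refine lt_of_lt_of_le ?_ (measure_mono (interior_subset (s := A)))
  rw [Measure.map_apply (h.measurable_Y d) isOpen_interior.measurableSet]
  rw [← h.law_U d, Measure.map_apply (h.measurable_U d) hCo.measurableSet] at h2
  refine h2.trans_le (measure_mono_ae ?_)
  filter_upwards [h.structural d] with ω hω hωC
  change Y d ω ∈ interior A
  rw [hω]
  exact hCA hωC

/-- Injectivity of `q d` on `O` identifies `U d ∈ B ∩ T` with `Y ∈ q d '' (B ∩ T)` almost surely on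
`D = d`, and the Jacobian formula pulls the outcome density back. Restricting to `T` is harmless
because the rank law is dominated by `μ`. -/
theorem IsModel.rankLaw_eq_withDensity (h : IsModel 𝒰 μ P Y D Z U ν q) [DiscreteMeasurableSpace 𝒟]
    {O : Set (Eucl p)} (hO : IsOpen O) (hμO : μ Oᶜ = 0) (hμs : O ⊆ μ.support)
    {T : Set (Eucl p)} (hTO : T ⊆ O) (hT : MeasurableSet T) (hμT : μ ≪ volume.restrict T) {d : 𝒟}
    (hq : ∀ u ∈ O, DifferentiableAt ℝ (q d) u) (hi : Set.InjOn (q d) O)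
    (hdet : ∀ u ∈ O, 0 < (jac (q d) u).det) {f : 𝒟 → 𝒵 → Eucl p → ℝ}
    (hf : IsDensityFamily P Y D Z f) (z : 𝒵) :
    rankLaw P D Z U d z = (volume.restrict T).withDensity
      fun u => ENNReal.ofReal (f d z (q d u) * (jac (q d) u).det) := by
  have hqc : ContinuousOn (q d) O := fun u hu => (hq u hu).continuousAt.continuousWithinAt
  have hκ : (P[|Z ⁻¹' {z}]).restrict (D ⁻¹' {d}) ≪ P :=
    Measure.restrict_le_self.absolutelyContinuous.trans cond_absolutelyContinuous
  have hmμ : rankLaw P D Z U d z ≪ μ := by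
    rw [← h.law_U d]
    exact hκ.map (h.measurable_U d)
  have hmT : rankLaw P D Z U d z Tᶜ = 0 := by
    refine hmμ (hμT ?_)
    rw [Measure.restrict_apply hT.compl]; simp
  have hobs : AEMeasurable (observed Y D) ((P[|Z ⁻¹' {z}]).restrict (D ⁻¹' {d})) := by
    refine (h.measurable_Y d).aemeasurable.congr ?_
    filter_upwards [ae_restrict_mem (h.measurable_D (measurableSet_singleton d))] with ω hω
    have : D ω = d := hω
    simp [observed, this]
  ext B hB
  have hBT : MeasurableSet (B ∩ T) := hB.inter hT
  have h1 : rankLaw P D Z U d z B = rankLaw P D Z U d z (B ∩ T) :=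
    (measure_inter_conull hmT).symm
  have himg : MeasurableSet (q d '' (B ∩ T)) :=
    hBT.image_of_continuousOn_injOn (hqc.mono (Set.inter_subset_right.trans hTO))
      (hi.mono (Set.inter_subset_right.trans hTO))
  have hsub : q d '' (B ∩ T) ⊆ outcomeSupport P Y d := by
    rintro _ ⟨u, hu, rfl⟩
    exact h.mem_outcomeSupport hO hμs d hqc (hTO hu.2)
  have h2 : rankLaw P D Z U d z (B ∩ T) =
      (((P[|Z ⁻¹' {z}]).restrict (D ⁻¹' {d})).map (observed Y D)) (q d '' (B ∩ T)) := by
    rw [rankLaw, Measure.map_apply (h.measurable_U d) hBT, Measure.map_apply_of_aemeasurable hobs himg]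
    refine measure_congr ?_
    filter_upwards [ae_restrict_mem (h.measurable_D (measurableSet_singleton d)),
      hκ.ae_le (h.ae_rank_mem hO.measurableSet hμO d), hκ.ae_le (h.structural d)] with ω h1 h2 h3
    have h1' : D ω = d := h1
    apply propext
    change U d ω ∈ B ∩ T ↔ Y (D ω) ω ∈ q d '' (B ∩ T)
    rw [h1', h3]
    refine ⟨fun h4 => ⟨_, h4, rfl⟩, ?_⟩
    rintro ⟨u, hu, he⟩
    rwa [← hi (hTO hu.2) h2 he]
  rw [h1, h2, (hf d z).2, withDensity_apply _ himg, Measure.restrict_restrict himg,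
    Set.inter_eq_left.2 hsub,
    lintegral_image_eq_lintegral_abs_det_fderiv_mul volume hBT
      (fun u hu => (hq u (hTO hu.2)).hasFDerivAt.hasFDerivWithinAt)
      (hi.mono (Set.inter_subset_right.trans hTO)),
    withDensity_apply _ hB, Measure.restrict_restrict hB]
  refine setLIntegral_congr_fun hBT fun u hu => ?_
  rw [det_fderiv_eq_det_jac, abs_of_pos (hdet u (hTO hu.2)), mul_comm (f d z (q d u)),
    ENNReal.ofReal_mul (hdet u (hTO hu.2)).le]

end Density

/-! ### The weighted quadratic form -/

section WeightedForm

variable {p : ℕ} {𝒟 : Type w₃} {𝒵 : Type w₄} [Fintype 𝒟] [Fintype 𝒵]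

theorem weightedForm_smul (b : Matrix 𝒟 𝒵 ℝ) (f : 𝒟 → 𝒵 → Eucl p → ℝ)
    (q : 𝒟 → Eucl p → Eucl p) (u : Eucl p) (t : ℝ) (ξ : 𝒟 → Fin p → ℝ) :
    weightedForm b f q u (t • ξ) = t ^ 2 * weightedForm b f q u ξ := by
  simp only [weightedForm, Pi.smul_apply, Matrix.mulVec_smul, smul_dotProduct, dotProduct_smul,
    Finset.mul_sum, smul_eq_mul]
  refine Finset.sum_congr rfl fun d _ => Finset.sum_congr rfl fun d' _ => ?_
  ring

theorem continuous_weightedForm (b : Matrix 𝒟 𝒵 ℝ) (f : 𝒟 → 𝒵 → Eucl p → ℝ)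
    (q : 𝒟 → Eucl p → Eucl p) (u : Eucl p) : Continuous (weightedForm b f q u) := by
  unfold weightedForm
  fun_prop

/-- The direction `(Dg(u))⁻¹ k(u)`. -/
noncomputable def inverseDirection (g k : Eucl p → Eucl p) (u : Eucl p) : Eucl p :=
  WithLp.toLp 2 ((jac g u)⁻¹.mulVec (k u).ofLp)

theorem fderiv_inverseDirection {g k : Eucl p → Eucl p} {u : Eucl p} (h : (jac g u).PosDef) :
    fderiv ℝ g u (inverseDirection g k u) = k u := by
  have := jac_mulVec g u (inverseDirection g k u)
  rw [inverseDirection, Matrix.mulVec_mulVec,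
    Matrix.mul_nonsing_inv _ (isUnit_iff_ne_zero.2 h.det_pos.ne'), Matrix.one_mulVec] at this
  exact (WithLp.ofLp_injective 2 this).symm

theorem continuousOn_jac {g : Eucl p → Eucl p} {O : Set (Eucl p)}
    (hg : ContinuousOn (fderiv ℝ g) O) : ContinuousOn (jac g) O := by
  refine continuousOn_pi.2 fun i => continuousOn_pi.2 fun j => ?_
  simp only [jac, Matrix.of_apply]
  exact ContinuousOn.comp (t := Set.univ) (g := fun x : Eucl p => x i) (by fun_prop)
    (hg.clm_apply continuousOn_const) fun _ _ => trivial

theorem continuousOn_inverseDirection {g k : Eucl p → Eucl p} {O : Set (Eucl p)}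
    (hg : ContinuousOn (fderiv ℝ g) O) (hdet : ∀ u ∈ O, (jac g u).det ≠ 0)
    (hk : ContinuousOn k O) : ContinuousOn (inverseDirection g k) O := by
  have hJ := continuousOn_jac hg
  have hI : ContinuousOn (fun u => (jac g u)⁻¹) O := by
    simp only [Matrix.inv_def, Ring.inverse_eq_inv']
    have h1 : ContinuousOn (fun u => (jac g u).det) O :=
      (continuous_id.matrix_det).comp_continuousOn hJ
    have h2 : ContinuousOn (fun u => (jac g u).adjugate) O :=
      (continuous_id.matrix_adjugate).comp_continuousOn hJ
    exact (h1.inv₀ hdet).smul h2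
  have h3 : ContinuousOn (fun u => (k u).ofLp) O :=
    (PiLp.continuous_ofLp 2 _).comp_continuousOn hk
  exact (PiLp.continuous_toLp 2 _).comp_continuousOn
    ((continuous_fst.matrix_mulVec continuous_snd).comp_continuousOn (hI.prodMk h3))

/-- Separates the rank density from the first-order coefficient of the expansion, so that the
integral of the form can be read as a mean over `(D, Z, U_D)`. -/
theorem weightedForm_eq_sum (b : Matrix 𝒟 𝒵 ℝ) (f : 𝒟 → 𝒵 → Eucl p → ℝ)
    (q h : 𝒟 → Eucl p → Eucl p) (u : Eucl p) :
    weightedForm b f q u (fun d => (h d u).ofLp) = ∑ d, ∑ z,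
      (f d z (q d u) * (jac (q d) u).det) *
        ∑ d', b d' z * inner ℝ (h d' u) (inverseDirection (q d) (h d) u) := by
  simp only [weightedForm, EuclideanSpace.inner_eq_star_dotProduct, star_trivial, inverseDirection,
    Finset.mul_sum, Finset.sum_mul]
  refine Finset.sum_congr rfl fun d _ => ?_
  rw [Finset.sum_comm]
  refine Finset.sum_congr rfl fun z _ => Finset.sum_congr rfl fun d' _ => ?_
  rw [dotProduct_comm]
  ring

end WeightedForm

/-! ### Means over treatment, instrument and rank -/

section Averages

variable {p : ℕ} {𝒟 : Type w₃} {𝒵 : Type w₄} [MeasurableSpace 𝒟] [MeasurableSpace 𝒵]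
  [Fintype 𝒟] [Fintype 𝒵] [DiscreteMeasurableSpace 𝒟] [DiscreteMeasurableSpace 𝒵]
  {Ω : Type*} [MeasurableSpace Ω] {P : Measure Ω} [IsProbabilityMeasure P]

theorem integrable_mul_of_withDensity {τ : Measure (Eucl p)} {g ρ : Eucl p → ℝ}
    (hg : AEMeasurable g τ) (hg0 : ∀ᵐ u ∂τ, 0 ≤ g u)
    (hρ : Integrable ρ (τ.withDensity fun u => ENNReal.ofReal (g u))) :
    Integrable (fun u => g u * ρ u) τ := by
  refine ((integrable_withDensity_iff_integrable_coe_smul₀ hg.real_toNNReal).1 hρ).congr ?_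
  filter_upwards [hg0] with u hu
  simp [hu]

theorem integral_mul_eq_integral_withDensity {τ : Measure (Eucl p)} {g ρ : Eucl p → ℝ}
    (hg : AEMeasurable g τ) (hg0 : ∀ᵐ u ∂τ, 0 ≤ g u) :
    ∫ u, ρ u ∂(τ.withDensity fun u => ENNReal.ofReal (g u)) = ∫ u, g u * ρ u ∂τ := by
  refine (integral_withDensity_eq_integral_smul₀ hg.real_toNNReal ρ).trans (integral_congr_ae ?_)
  filter_upwards [hg0] with u hu
  simp [NNReal.smul_def, hu]

theorem integral_eq_sum_cond {D : Ω → 𝒟} {Z : Ω → 𝒵} (hD : Measurable D) (hZ : Measurable Z)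
    {F : Ω → ℝ} (hF : Integrable F P) :
    ∫ ω, F ω ∂P = ∑ d, ∑ z, P.real (Z ⁻¹' {z}) *
      ∫ ω, F ω ∂((P[|Z ⁻¹' {z}]).restrict (D ⁻¹' {d})) := by
  have hFc : ∀ z, Integrable F (P[|Z ⁻¹' {z}]) := fun z => by
    -- Conditioning on a null event gives the zero measure, so the decomposition needs no
    -- positivity.
    by_cases h0 : P (Z ⁻¹' {z}) = 0
    · rw [cond_eq_zero_of_meas_eq_zero h0]; exact integrable_zero_measure
    · exact (hF.restrict).smul_measure (ENNReal.inv_ne_top.2 h0)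
  have h1 : ∀ z, ∫ ω, F ω ∂(P[|Z ⁻¹' {z}]) =
      ∑ d, ∫ ω in D ⁻¹' {d}, F ω ∂(P[|Z ⁻¹' {z}]) := fun z => by
    rw [← integral_biUnion_finset Finset.univ (fun d _ => hD (measurableSet_singleton d)) ?_
      fun d _ => (hFc z).integrableOn]
    · have : (⋃ d ∈ (Finset.univ : Finset 𝒟), D ⁻¹' {d}) = Set.univ := by ext; simp
      rw [this, Measure.restrict_univ]
    · intro d _ d' _ hdd
      exact Set.disjoint_left.2 fun ω h1 h2 => hdd (h1.symm.trans h2)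
  rw [Finset.sum_comm]
  simp only [← Finset.mul_sum, ← h1]
  conv_lhs => rw [← sum_meas_smul_cond_fiber hZ P]
  rw [integral_finsetSum_measure fun z _ => (hFc z).smul_measure (measure_ne_top _ _)]
  simp [integral_smul_measure, Measure.real]

/-- Reweighting by the inverse probability of the instrument. -/
theorem integral_inverse_weighted {D : Ω → 𝒟} {Z : Ω → 𝒵} {U : 𝒟 → Ω → Eucl p}
    (hD : Measurable D) (hZ : Measurable Z) (hU : ∀ d, Measurable (U d))
    (hZ0 : ∀ z, P (Z ⁻¹' {z}) ≠ 0) {τ : Measure (Eucl p)} {g ρ : 𝒟 → 𝒵 → Eucl p → ℝ}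
    (hg : ∀ d z, AEMeasurable (g d z) τ) (hg0 : ∀ d z, ∀ᵐ u ∂τ, 0 ≤ g d z u)
    (hlaw : ∀ d z, rankLaw P D Z U d z = τ.withDensity fun u => ENNReal.ofReal (g d z u))
    (hρ : ∀ d z, Measurable (ρ d z)) {C : ℝ} (hC : ∀ d z u, |ρ d z u| ≤ C) :
    Integrable (fun ω => (P.real (Z ⁻¹' {Z ω}))⁻¹ * ρ (D ω) (Z ω) (U (D ω) ω)) P ∧
    Integrable (fun u => ∑ d, ∑ z, g d z u * ρ d z u) τ ∧
    ∫ ω, (P.real (Z ⁻¹' {Z ω}))⁻¹ * ρ (D ω) (Z ω) (U (D ω) ω) ∂P =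
      ∫ u, ∑ d, ∑ z, g d z u * ρ d z u ∂τ := by
  have hfin : ∀ d z, IsFiniteMeasure (rankLaw P D Z U d z) := fun d z => by
    unfold rankLaw; infer_instance
  have hint : ∀ d z, Integrable (fun u => g d z u * ρ d z u) τ := fun d z => by
    refine integrable_mul_of_withDensity (hg d z) (hg0 d z) ?_
    rw [← hlaw]
    exact Integrable.of_bound (hρ d z).aestronglyMeasurable C (Filter.Eventually.of_forall (hC d z))
  have hm : Measurable fun ω => (P.real (Z ⁻¹' {Z ω}))⁻¹ * ρ (D ω) (Z ω) (U (D ω) ω) := by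
    refine Measurable.mul ((measurable_of_finite fun z => (P.real (Z ⁻¹' {z}))⁻¹).comp hZ) ?_
    have : ∀ x : 𝒟 × 𝒵, Measurable fun ω => ρ x.1 x.2 (U x.1 ω) := fun x => (hρ _ _).comp (hU _)
    exact measurable_comp_index this (hD.prodMk hZ)
  have hF : Integrable (fun ω => (P.real (Z ⁻¹' {Z ω}))⁻¹ * ρ (D ω) (Z ω) (U (D ω) ω)) P := by
    refine Integrable.of_bound hm.aestronglyMeasurable ((∑ z, (P.real (Z ⁻¹' {z}))⁻¹) * C)
      (Filter.Eventually.of_forall fun ω => ?_)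
    rw [norm_mul, Real.norm_of_nonneg (by positivity)]
    refine mul_le_mul ?_ (hC _ _ _) (norm_nonneg _) (Finset.sum_nonneg fun _ _ => by positivity)
    exact Finset.single_le_sum (f := fun z => (P.real (Z ⁻¹' {z}))⁻¹)
      (fun _ _ => by positivity) (Finset.mem_univ _)
  refine ⟨hF, integrable_finsetSum _ fun d _ => integrable_finsetSum _ fun z _ => hint d z, ?_⟩
  rw [integral_eq_sum_cond hD hZ hF,
    integral_finsetSum _ fun d _ => integrable_finsetSum _ fun z _ => hint d z]
  refine Finset.sum_congr rfl fun d _ => ?_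
  rw [integral_finsetSum _ fun z _ => hint d z]
  refine Finset.sum_congr rfl fun z _ => ?_
  rw [← integral_mul_eq_integral_withDensity (hg d z) (hg0 d z), ← hlaw, rankLaw,
    integral_map (hU d).aemeasurable (hρ d z).aestronglyMeasurable]
  -- On `Z = z` the inverse weight is constant and cancels the factor `P(Z = z)` of the
  -- decomposition.
  have hz : P.real (Z ⁻¹' {z}) ≠ 0 := (measureReal_ne_zero_iff (measure_ne_top _ _)).2 (hZ0 z)
  have hZz : ∀ᵐ ω ∂(P[|Z ⁻¹' {z}]), Z ω = z := by
    have : ∀ᵐ ω ∂(P[|Z ⁻¹' {z}]), ω ∈ Z ⁻¹' {z} := ae_cond_mem (hZ (measurableSet_singleton z))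
    exact this
  have : ∫ ω in D ⁻¹' {d}, (P.real (Z ⁻¹' {Z ω}))⁻¹ * ρ (D ω) (Z ω) (U (D ω) ω) ∂(P[|Z ⁻¹' {z}]) =
      ∫ ω in D ⁻¹' {d}, (P.real (Z ⁻¹' {z}))⁻¹ * ρ d z (U d ω) ∂(P[|Z ⁻¹' {z}]) := by
    refine integral_congr_ae ?_
    filter_upwards [ae_restrict_mem (hD (measurableSet_singleton d)), ae_restrict_of_ae hZz]
      with ω h1 h2
    have h1' : D ω = d := h1
    simp only [h1', h2]
  rw [this, integral_const_mul, ← mul_assoc, mul_inv_cancel₀ hz, one_mul]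

end Averages

/-! ### Extension to the boundary and comparison of means -/

section Identification

variable {p : ℕ}

theorem MemC.differentiableAt {F : Type*} [NormedAddCommGroup F] [NormedSpace ℝ F]
    {S : Set (Eucl p)} {g : Eucl p → F} (hg : MemC 2 S g) :
    ∀ x ∈ interior S, DifferentiableAt ℝ g x := fun _ hx =>
  (hg.2.1.differentiableOn (by norm_num)).differentiableAt (isOpen_interior.mem_nhds hx)

theorem MemC.continuousOn_fderiv {F : Type*} [NormedAddCommGroup F] [NormedSpace ℝ F]
    {S : Set (Eucl p)} {g : Eucl p → F} (hg : MemC 2 S g) :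
    ContinuousOn (fderiv ℝ g) (interior S) :=
  hg.2.1.continuousOn_fderiv_of_isOpen isOpen_interior (by norm_num)

/-- A closed convex set with nonempty interior is the closure of that interior, so the Lipschitz
bound passes to the boundary by continuity. -/
theorem norm_sub_le_of_norm_fderiv_interior_le {S : Set (Eucl p)} (hS : IsClosed S)
    (hSc : Convex ℝ S) (hne : (interior S).Nonempty) {g : Eucl p → Eucl p}
    (hc : ContinuousOn g S) (hd : ∀ x ∈ interior S, DifferentiableAt ℝ g x) {K : ℝ} (hK : 0 ≤ K)
    (hb : ∀ x ∈ interior S, ‖fderiv ℝ g x‖ ≤ K) :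
    ∀ x ∈ S, ∀ y ∈ S, ‖g y - g x‖ ≤ K * ‖y - x‖ := by
  have hcl : closure (interior S) = S := by
    rw [hSc.closure_interior_eq_closure_of_nonempty_interior hne, hS.closure_eq]
  have h1 : LipschitzOnWith ⟨K, hK⟩ g (interior S) :=
    hSc.interior.lipschitzOnWith_of_nnnorm_fderiv_le hd hb
  have h2 : LipschitzOnWith ⟨K, hK⟩ g S := by
    have := h1.closure (by rwa [hcl])
    rwa [hcl] at this
  intro x hx y hy
  have := h2.dist_le_mul y hy x hx
  rwa [dist_eq_norm, dist_eq_norm] at this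

theorem exists_bound_of_hasFDerivAt {O : Set (Eucl p)} (hO : Convex ℝ O)
    (hOb : Bornology.IsBounded O) {ψ : Eucl p → ℝ} {ψ' : Eucl p → Eucl p →L[ℝ] ℝ}
    (hψ : ∀ x ∈ O, HasFDerivAt ψ (ψ' x) x) {H : ℝ} (hH : ∀ x ∈ O, ‖ψ' x‖ ≤ H) :
    ∃ B : ℝ, ∀ x ∈ O, |ψ x| ≤ B := by
  rcases O.eq_empty_or_nonempty with rfl | ⟨x₀, hx₀⟩
  · exact ⟨0, by simp⟩
  · have hH0 : 0 ≤ H := (norm_nonneg _).trans (hH x₀ hx₀)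
    refine ⟨H * Metric.diam O + |ψ x₀|, fun x hx => ?_⟩
    have h1 := hO.norm_image_sub_le_of_norm_hasFDerivWithin_le
      (fun y hy => (hψ y hy).hasFDerivWithinAt) hH hx₀ hx
    have h2 : ‖x - x₀‖ ≤ Metric.diam O := by
      rw [← dist_eq_norm]; exact Metric.dist_le_diam_of_mem hOb hx hx₀
    have h3 := abs_sub_abs_le_abs_sub (ψ x) (ψ x₀)
    rw [Real.norm_eq_abs] at h1
    have h4 := mul_le_mul_of_nonneg_left h2 hH0
    linarith

/-- If `(V, Z)` and `(W, Z)` have the same distribution and `φ_Z(V) - φ_Z(W)` differs from `-a R` by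
at most `C`, then the mean of `a R` is at most `C` in absolute value. -/
theorem abs_mul_integral_le_of_map_eq {𝒵 : Type w₄} [MeasurableSpace 𝒵] [Fintype 𝒵]
    [DiscreteMeasurableSpace 𝒵] {Ω : Type*} [MeasurableSpace Ω] {P : Measure Ω}
    [IsProbabilityMeasure P] {V W : Ω → Eucl p} {Z : Ω → 𝒵} (hV : Measurable V)
    (hW : Measurable W) (hZ : Measurable Z)
    (hlaw : P.map (fun ω => (V ω, Z ω)) = P.map (fun ω => (W ω, Z ω)))
    {O : Set (Eucl p)} (hO : MeasurableSet O) (hVO : ∀ᵐ ω ∂P, V ω ∈ O) (hWO : ∀ᵐ ω ∂P, W ω ∈ O)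
    {φ : 𝒵 → Eucl p → ℝ} (hφ : ∀ z, ContinuousOn (φ z) O) {B : ℝ}
    (hB : ∀ z, ∀ x ∈ O, |φ z x| ≤ B) {R : Ω → ℝ} (hR : Integrable R P) {a C : ℝ}
    (hC : ∀ᵐ ω ∂P, |φ (Z ω) (V ω) - φ (Z ω) (W ω) + a * R ω| ≤ C) :
    |a * ∫ ω, R ω ∂P| ≤ C := by
  set Φ : Eucl p × 𝒵 → ℝ := fun x => O.indicator (φ x.2) x.1
  have hΦ : Measurable Φ := by
    have : Measurable fun x : 𝒵 × Eucl p => O.indicator (φ x.1) x.2 :=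
      measurable_from_prod_countable_right fun z => measurable_piecewise_zero hO (hφ z)
    exact this.comp measurable_swap
  have hΦV : ∀ᵐ ω ∂P, Φ (V ω, Z ω) = φ (Z ω) (V ω) := by
    filter_upwards [hVO] with ω hω using Set.indicator_of_mem hω _
  have hΦW : ∀ᵐ ω ∂P, Φ (W ω, Z ω) = φ (Z ω) (W ω) := by
    filter_upwards [hWO] with ω hω using Set.indicator_of_mem hω _
  have hiV : Integrable (fun ω => Φ (V ω, Z ω)) P := by
    refine Integrable.of_bound (hΦ.comp (hV.prodMk hZ)).aestronglyMeasurable B ?_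
    filter_upwards [hVO, hΦV] with ω h1 h2
    rw [h2]; exact hB _ _ h1
  have hiW : Integrable (fun ω => Φ (W ω, Z ω)) P := by
    refine Integrable.of_bound (hΦ.comp (hW.prodMk hZ)).aestronglyMeasurable B ?_
    filter_upwards [hWO, hΦW] with ω h1 h2
    rw [h2]; exact hB _ _ h1
  have heq : ∫ ω, Φ (V ω, Z ω) ∂P = ∫ ω, Φ (W ω, Z ω) ∂P := by
    rw [← integral_map (hV.prodMk hZ).aemeasurable hΦ.aestronglyMeasurable, hlaw,
      integral_map (hW.prodMk hZ).aemeasurable hΦ.aestronglyMeasurable]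
  have hsum : a * ∫ ω, R ω ∂P = ∫ ω, (Φ (V ω, Z ω) - Φ (W ω, Z ω) + a * R ω) ∂P := by
    have h1 := integral_add (hiV.sub hiW) (hR.const_mul a)
    simp only [Pi.sub_apply] at h1
    rw [h1, integral_sub hiV hiW, heq, integral_const_mul]
    ring
  rw [hsum]
  have := norm_integral_le_of_norm_le_const (μ := P) (C := C)
    (f := fun ω => Φ (V ω, Z ω) - Φ (W ω, Z ω) + a * R ω) (by
      filter_upwards [hC, hΦV, hΦW] with ω h1 h2 h3
      rw [h2, h3]; exact h1)
  simpa using this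

/-- Symmetry of the derivative passes to the direction of a perturbation. -/
theorem inner_fderiv_comm_of_perturbation {O : Set (Eucl p)} (hO : IsOpen O)
    {g q k : Eucl p → Eucl p} {a : ℝ} (ha : a ≠ 0) (hg : ∀ x ∈ O, DifferentiableAt ℝ g x)
    (hk : ∀ x ∈ O, DifferentiableAt ℝ k x) (hq : ∀ x ∈ O, q x = g x + a • k x)
    (hgp : ∀ x ∈ O, (jac g x).PosDef) (hqp : ∀ x ∈ O, (jac q x).PosDef) :
    ∀ u ∈ O, ∀ x y, inner ℝ (fderiv ℝ k u x) y = inner ℝ (fderiv ℝ k u y) x := by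
  intro u hu x y
  have h1 : fderiv ℝ q u = fderiv ℝ g u + a • fderiv ℝ k u := by
    have : q =ᶠ[nhds u] fun x => g x + a • k x :=
      Filter.eventually_of_mem (hO.mem_nhds hu) hq
    rw [this.fderiv_eq]
    exact ((hg u hu).hasFDerivAt.add ((hk u hu).hasFDerivAt.const_smul a)).fderiv
  have h2 := inner_fderiv_comm (hqp u hu) x y
  have h3 := inner_fderiv_comm (hgp u hu) x y
  simp only [h1, add_apply, smul_apply, inner_add_left,
    real_inner_smul_left, h3, add_right_inj] at h2
  exact mul_left_cancel₀ ha h2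

end Identification

theorem injOn_of_expansive {p : ℕ} {O : Set (Eucl p)} {g : Eucl p → Eucl p} {lo : ℝ} (hlo : 0 < lo)
    (hg : ∀ x ∈ O, ∀ y ∈ O, lo * ‖y - x‖ ≤ ‖g y - g x‖) : Set.InjOn g O := by
  intro x hx y hy hxy
  have h1 := hg x hx y hy
  rw [hxy, sub_self, norm_zero] at h1
  have h2 : ‖y - x‖ ≤ 0 := by
    by_contra h0
    push Not at h0
    nlinarith
  exact (sub_eq_zero.1 (norm_le_zero_iff.1 h2)).symm

end IVQR

/-! ### Proof of local identification -/

open IVQR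

theorem theoremD1
    {p : ℕ} {𝒟 : Type w₃} {𝒵 : Type w₄}
    [Fintype 𝒟] [MeasurableSpace 𝒟] [DiscreteMeasurableSpace 𝒟]
    [Fintype 𝒵] [MeasurableSpace 𝒵] [DiscreteMeasurableSpace 𝒵]
    -- the reference distribution `μ` and its support `𝒰`
    (𝒰 : Set (IVQR.Eucl p)) (h𝒰_compact : IsCompact 𝒰) (h𝒰_convex : Convex ℝ 𝒰)
    (h𝒰_boundary : IVQR.HasPiecewiseBoundary 1 𝒰)
    (μ : MeasureTheory.Measure (IVQR.Eucl p)) [MeasureTheory.IsProbabilityMeasure μ]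
    (hμ_support : μ.support = 𝒰) (hμ_ac : μ ≪ MeasureTheory.volume)
    -- the constants defining the parameter space
    (lo hi K : ℝ) (hlo : 0 < lo) (hlohi : lo < hi) (hK : 0 < K)
    -- the model with true structural function `qs`
    {Ω : Type*} [MeasurableSpace Ω] (P : MeasureTheory.Measure Ω)
    [MeasureTheory.IsProbabilityMeasure P]
    {N : Type*} [MeasurableSpace N]
    (Y : 𝒟 → Ω → IVQR.Eucl p) (D : Ω → 𝒟) (Z : Ω → 𝒵) (U : 𝒟 → Ω → IVQR.Eucl p) (ν : Ω → N)
    (qs : 𝒟 → IVQR.Eucl p → IVQR.Eucl p)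
    (hmodel : IVQR.IsModel 𝒰 μ P Y D Z U ν qs)
    (hZ : ∀ z, P (Z ⁻¹' {z}) ≠ 0)
    -- correct specification
    (hspec : qs ∈ IVQR.spaceQ0 𝒰 lo hi K qs)
    -- regular supports of the potential outcomes
    (hY_convex : ∀ d, Convex ℝ (IVQR.outcomeSupport P Y d))
    (hY_compact : ∀ d, IsCompact (IVQR.outcomeSupport P Y d))
    (hY_boundary : ∀ d, IVQR.HasPiecewiseBoundary 2 (IVQR.outcomeSupport P Y d))
    -- smooth densities
    (f : 𝒟 → 𝒵 → IVQR.Eucl p → ℝ) (hf_density : IVQR.IsDensityFamily P Y D Z f)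
    (hf_smooth : ∀ d z, IVQR.MemC 1 (IVQR.outcomeSupport P Y d) (f d z))
    -- positive definiteness of the weighted quadratic form
    (hpos : ∃ b : Matrix 𝒟 𝒵 ℝ, ∀ᵐ u ∂μ, ∀ ξ : 𝒟 → Fin p → ℝ, ξ ≠ 0 →
      0 < IVQR.weightedForm b f qs u ξ) :
    IVQR.IsLocallyIdentified.{w₁, w₂, w₃, w₄} 𝒰 μ (IVQR.observedLaw P Y D Z)
      (IVQR.spaceQ0 𝒰 lo hi K qs) qs := by
  classical
  obtain ⟨b, hb⟩ := hpos
  obtain ⟨⟨hqsC, hqsE⟩, -⟩ := hspec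
  have hOc : Convex ℝ (interior 𝒰) := h𝒰_convex.interior
  have hOo : IsOpen (interior 𝒰) := isOpen_interior
  have hOm : MeasurableSet (interior 𝒰) := hOo.measurableSet
  -- The frontier of a convex set is Lebesgue-null, so all ranks may be taken in the interior.
  have hμO : μ (interior 𝒰)ᶜ = 0 := by
    refine measure_mono_null (t := μ.supportᶜ ∪ frontier 𝒰) (fun x hx => ?_)
      (measure_union_null Measure.measure_compl_support
        (hμ_ac (h𝒰_convex.addHaar_frontier volume)))
    by_cases hxU : x ∈ 𝒰
    · exact Or.inr ⟨subset_closure hxU, hx⟩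
    · exact Or.inl (by rwa [hμ_support])
  have hOne : (interior 𝒰).Nonempty := by
    by_contra h0
    rw [Set.not_nonempty_iff_eq_empty] at h0
    simp [h0] at hμO
  have hOs : interior 𝒰 ⊆ μ.support := hμ_support ▸ interior_subset
  -- the true structural function
  have hgd : ∀ d, ∀ u ∈ interior 𝒰, DifferentiableAt ℝ (qs d) u := fun d => (hqsC d).differentiableAt
  have hgc : ∀ d, ContinuousOn (qs d) (interior 𝒰) := fun d => (hqsC d).1.mono interior_subset
  have hglo : ∀ d, ∀ u ∈ interior 𝒰, ∀ y, lo * ‖y‖ ^ 2 ≤ inner ℝ (fderiv ℝ (qs d) u y) y :=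
    fun d u hu => mul_sq_norm_le_inner_fderiv (hqsE d u hu).1 fun t ht => ((hqsE d u hu).2 t ht).1
  have hgdet : ∀ d, ∀ u ∈ interior 𝒰, 0 < (jac (qs d) u).det := fun d u hu =>
    (hqsE d u hu).1.det_pos
  have hgi : ∀ d, Set.InjOn (qs d) (interior 𝒰) := fun d =>
    injOn_of_expansive hlo fun x hx y hy => mul_norm_sub_le hOc (hgd d) (hglo d) hx hy
  choose M' hM'0 hM' using fun d => (hqsC d).exists_lipschitz_fderiv h𝒰_compact h𝒰_convex
  obtain ⟨M, hM0, hM⟩ : ∃ M : ℝ, 0 ≤ M ∧ ∀ d, M' d ≤ M :=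
    ⟨∑ d, M' d, Finset.sum_nonneg fun d _ => hM'0 d,
      fun d => Finset.single_le_sum (fun d _ => hM'0 d) (Finset.mem_univ d)⟩
  have hgM : ∀ d, ∀ x ∈ interior 𝒰, ∀ y ∈ interior 𝒰,
      ‖fderiv ℝ (qs d) y - fderiv ℝ (qs d) x‖ ≤ M * ‖y - x‖ := fun d x hx y hy =>
    (hM' d x hx y hy).trans (by gcongr; exact hM d)
  -- the reference measure
  obtain ⟨T, hTO, hT, hμT, hTμ⟩ := exists_equivalent_restrict hμ_ac hOm hμO
  set τ : Measure (Eucl p) := volume.restrict T with hτ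
  have hτfin : IsFiniteMeasure τ := ⟨by
    rw [hτ, Measure.restrict_apply_univ]
    exact (measure_mono (hTO.trans interior_subset)).trans_lt h𝒰_compact.measure_lt_top⟩
  have hτO : ∀ᵐ u ∂τ, u ∈ interior 𝒰 := by
    filter_upwards [ae_restrict_mem hT] with u hu using hTO hu
  have hτball : ∀ x ∈ 𝒰, ∀ r > 0, 0 < τ (Metric.ball x r) := fun x hx r hr => by
    refine pos_iff_ne_zero.2 fun h0 => ?_
    exact ((Measure.mem_support_iff_forall x).1 (hμ_support ▸ hx) _
      (Metric.ball_mem_nhds x hr)).ne' (hμT h0)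
  -- The bound `c` is fixed before any alternative is considered; positivity passes from `μ` to `τ`
  -- because `τ ≪ μ`.
  obtain ⟨c, hc0, hc⟩ := exists_pos_le_integral_form h𝒰_compact
    (hτO.mono fun u hu => interior_subset hu) hτball
    (continuous_weightedForm b f qs) (weightedForm_smul b f qs) (hTμ.ae_le hb) hK
  -- the densities of the ranks
  have hsupp : ∀ d, ∀ u ∈ interior 𝒰, qs d u ∈ outcomeSupport P Y d := fun d u hu =>
    hmodel.mem_outcomeSupport hOo hOs d (hgc d) hu
  have hdens : ∀ d z, rankLaw P D Z U d z = τ.withDensity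
      fun u => ENNReal.ofReal (f d z (qs d u) * (jac (qs d) u).det) := fun d z =>
    hmodel.rankLaw_eq_withDensity hOo hμO hOs hTO hT hμT (hgd d) (hgi d) (hgdet d) hf_density z
  have hdens_meas : ∀ d z, AEMeasurable (fun u => f d z (qs d u) * (jac (qs d) u).det) τ := by
    intro d z
    have h1 : ContinuousOn (fun u => f d z (qs d u)) (interior 𝒰) :=
      (hf_smooth d z).1.comp (hgc d) (hsupp d)
    have h2 : ContinuousOn (fun u => (jac (qs d) u).det) (interior 𝒰) :=
      continuous_id.matrix_det.comp_continuousOn (continuousOn_jac (hqsC d).continuousOn_fderiv)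
    exact ((h1.mul h2).mono hTO).aemeasurable hT
  have hdens_nonneg : ∀ d z, ∀ᵐ u ∂τ, 0 ≤ f d z (qs d u) * (jac (qs d) u).det := by
    intro d z
    filter_upwards [hτO] with u hu
    exact mul_nonneg ((hf_density d z).1 _ (hsupp d u hu)) (hgdet d u hu).le
  -- the constants
  set H : ℝ := p * 1
  have hH0 : 0 ≤ H := by positivity
  -- `C₁` is the constant of `abs_expansion_le`; `C₂` bounds the same error for the weighted
  -- combination of potentials, for every value of the instrument.
  set C₁ : ℝ := K * (H / lo) ^ 2 + H * ((M * (H / lo) ^ 2 + K * (H / lo)) / lo)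
  have hC₁ : 0 ≤ C₁ := by positivity
  set C₂ : ℝ := ∑ z, (P.real (Z ⁻¹' {z}))⁻¹ * ∑ d', |b d' z| * C₁
  have hC₂ : 0 ≤ C₂ := Finset.sum_nonneg fun z _ =>
    mul_nonneg (by positivity) (Finset.sum_nonneg fun d _ => by positivity)
  -- Any radius with `C₂ * ε < c` would do; the `+ 1` covers `C₂ = 0`.
  refine ⟨c / (C₂ + 1), by positivity, ?_⟩
  intro Ω' _ P' _ N' _ Y' D' Z' U' ν' q ⟨⟨⟨hqC, hqE⟩, a, h, ha, hhC, hh1, hhK, hqh⟩, hnear⟩ hne hmodel'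
    hlaw
  have ha0 : a ≠ 0 := by
    rintro rfl
    obtain ⟨d, hd⟩ := hne
    exact hd fun u hu => by simpa using hqh d u hu
  have hapos : 0 < a := lt_of_le_of_ne ha ha0.symm
  have hqO : ∀ d, ∀ u ∈ interior 𝒰, q d u = qs d u + a • h d u := fun d u hu =>
    hqh d u (interior_subset hu)
  -- As `h` has norm one, the distance from `q` to `qs` is exactly `a`.
  rw [normQ_eq_mul (h := h) ha (fun d u hu => by rw [hqh d u hu, add_sub_cancel_left]), hh1,
    mul_one] at hnear
  -- regularity of the alternative and of the direction
  have hhd : ∀ d, ∀ u ∈ interior 𝒰, DifferentiableAt ℝ (h d) u := fun d => (hhC d).differentiableAt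
  have hhc : ∀ d, ContinuousOn (h d) (interior 𝒰) := fun d => (hhC d).1.mono interior_subset
  have hhL : ∀ d, ∀ x ∈ 𝒰, ∀ y ∈ 𝒰, ‖h d y - h d x‖ ≤ K * ‖y - x‖ := fun d =>
    norm_sub_le_of_norm_fderiv_interior_le h𝒰_compact.isClosed h𝒰_convex hOne (hhC d).1 (hhd d)
      hK.le (hhK d)
  have hhLO : ∀ d, ∀ x ∈ interior 𝒰, ∀ y ∈ interior 𝒰, ‖h d y - h d x‖ ≤ K * ‖y - x‖ :=
    fun d x hx y hy => hhL d x (interior_subset hx) y (interior_subset hy)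
  have hhH : ∀ d, ∀ u ∈ interior 𝒰, ‖h d u‖ ≤ H := fun d u hu =>
    norm_le_of_abs_le fun i => hh1 ▸ abs_le_normQ h𝒰_compact (fun d => (hhC d).1) d
      (interior_subset hu) i
  have hqd : ∀ d, ∀ u ∈ interior 𝒰, DifferentiableAt ℝ (q d) u := fun d => (hqC d).differentiableAt
  have hqexp : ∀ d, ∀ x ∈ interior 𝒰, ∀ y ∈ interior 𝒰, lo * ‖y - x‖ ≤ ‖q d y - q d x‖ :=
    fun d x hx y hy => mul_norm_sub_le hOc (hqd d)
      (fun u hu => mul_sq_norm_le_inner_fderiv (hqE d u hu).1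
        fun t ht => ((hqE d u hu).2 t ht).1) hx hy
  choose ψ hψ using fun d => exists_potential hOc hOo (hhd d)
    (inner_fderiv_comm_of_perturbation hOo ha0 (hgd d) (hhd d) (hqO d)
      (fun u hu => (hqsE d u hu).1) fun u hu => (hqE d u hu).1)
  choose Bψ hBψ using fun d => exists_bound_of_hasFDerivAt hOc
    (h𝒰_compact.isBounded.subset interior_subset) (hψ d) (H := H)
    (fun u hu => by rw [innerSL_apply_norm]; exact hhH d u hu)
  have hinv : ∀ d, ∀ u ∈ interior 𝒰, ‖inverseDirection (qs d) (h d) u‖ ≤ H / lo := by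
    intro d u hu
    have h1 := mul_norm_le_norm_of_inner (hglo d u hu (inverseDirection (qs d) (h d) u))
    rw [fderiv_inverseDirection (hqsE d u hu).1] at h1
    rw [le_div_iff₀ hlo, mul_comm]
    exact h1.trans (hhH d u hu)
  -- the weighted quadratic form as a mean
  set ρ₀ : 𝒟 → 𝒵 → Eucl p → ℝ := fun d z u =>
    ∑ d', b d' z * inner ℝ (h d' u) (inverseDirection (qs d) (h d) u) with hρ₀
  -- Cutting off outside the interior makes the coefficient measurable and bounded everywhere,
  -- without changing it almost everywhere.
  set ρ : 𝒟 → 𝒵 → Eucl p → ℝ := fun d z => (interior 𝒰).indicator (ρ₀ d z) with hρ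
  have hρm : ∀ d z, Measurable (ρ d z) := fun d z => by
    refine measurable_piecewise_zero hOm (continuousOn_finsetSum _ fun d' _ => ?_)
    exact continuousOn_const.mul ((hhc d').inner (continuousOn_inverseDirection
      (hqsC d).continuousOn_fderiv (fun u hu => (hgdet d u hu).ne') (hhc d)))
  have hρb : ∀ d z u, |ρ d z u| ≤ ∑ z, ∑ d', |b d' z| * (H * (H / lo)) := by
    intro d z u
    have hnn : ∀ z, 0 ≤ ∑ d', |b d' z| * (H * (H / lo)) := fun z =>
      Finset.sum_nonneg fun d' _ => by positivity
    by_cases hu : u ∈ interior 𝒰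
    · simp only [hρ, Set.indicator_of_mem hu]
      refine le_trans ?_ (Finset.single_le_sum (fun z _ => hnn z) (Finset.mem_univ z))
      refine (Finset.abs_sum_le_sum_abs _ _).trans (Finset.sum_le_sum fun d' _ => ?_)
      rw [abs_mul]
      refine mul_le_mul_of_nonneg_left ?_ (abs_nonneg _)
      exact (abs_real_inner_le_norm _ _).trans
        (mul_le_mul (hhH d' u hu) (hinv d u hu) (norm_nonneg _) hH0)
    · simp only [hρ, Set.indicator_of_notMem hu, abs_zero]
      exact Finset.sum_nonneg fun z _ => hnn z
  obtain ⟨hRint, hFint, hReq⟩ := integral_inverse_weighted hmodel.measurable_D hmodel.measurable_Z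
    hmodel.measurable_U hZ hdens_meas hdens_nonneg hdens hρm hρb
  have hFeq : (fun u => ∑ d, ∑ z, f d z (qs d u) * (jac (qs d) u).det * ρ d z u) =ᵐ[τ]
      fun u => weightedForm b f qs u fun d => (h d u).ofLp := by
    filter_upwards [hτO] with u hu
    rw [weightedForm_eq_sum]
    simp only [hρ, hρ₀, Set.indicator_of_mem hu]
  have hcR := hc h hh1 hhL (hFint.congr hFeq)
  rw [← integral_congr_ae hFeq, ← hReq] at hcR
  -- comparison of the two models
  obtain ⟨V, hVm, hVq, hVlaw⟩ := exists_reconstructed_rank hmodel.measurable_Y hmodel.measurable_D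
    hmodel.measurable_Z hmodel' hlaw hOm hμO
    (fun d u hu => (hqd d u hu).continuousAt.continuousWithinAt)
    (fun d => injOn_of_expansive hlo (hqexp d))
  have hobs := hmodel.ae_observed_eq hOm hμO
  -- The weighted potentials have equal means at `V` and at `U_D`; only the first-order term and an
  -- error of at most `C₂ * a ^ 2` remain.
  have hbound := abs_mul_integral_le_of_map_eq (a := a) (C := C₂ * a ^ 2) hVm
    (measurable_comp_index hmodel.measurable_U hmodel.measurable_D) hmodel.measurable_Z
    (hVlaw.trans hmodel.map_observed_rank.symm) hOm (hVq.mono fun ω hω => hω.1)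
    (hobs.mono fun ω hω => hω.1)
    (φ := fun z x => (P.real (Z ⁻¹' {z}))⁻¹ * ∑ d', b d' z * ψ d' x)
    (fun z => continuousOn_const.mul (continuousOn_finsetSum _ fun d' _ =>
      continuousOn_const.mul fun x hx => (hψ d' x hx).continuousAt.continuousWithinAt))
    (B := ∑ z, (P.real (Z ⁻¹' {z}))⁻¹ * ∑ d', |b d' z| * |Bψ d'|)
    (fun z x hx => by
      refine le_trans ?_ (Finset.single_le_sum (fun z _ => mul_nonneg (by positivity)
        (Finset.sum_nonneg fun d' _ => by positivity)) (Finset.mem_univ z))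
      rw [abs_mul, abs_of_nonneg (by positivity : 0 ≤ (P.real (Z ⁻¹' {z}))⁻¹)]
      refine mul_le_mul_of_nonneg_left ?_ (by positivity)
      refine (Finset.abs_sum_le_sum_abs _ _).trans (Finset.sum_le_sum fun d' _ => ?_)
      rw [abs_mul]
      exact mul_le_mul_of_nonneg_left ((hBψ d' x hx).trans (le_abs_self _)) (abs_nonneg _))
    hRint (by
      filter_upwards [hVq, hobs] with ω hV hU
      set u := U (D ω) ω
      set z := Z ω
      set d := D ω
      have hmem : ρ d z u = ρ₀ d z u := Set.indicator_of_mem hU.1 _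
      have hsplit : (P.real (Z ⁻¹' {z}))⁻¹ * ∑ d', b d' z * ψ d' (V ω) -
          (P.real (Z ⁻¹' {z}))⁻¹ * ∑ d', b d' z * ψ d' u +
          a * ((P.real (Z ⁻¹' {z}))⁻¹ * ρ d z u) = (P.real (Z ⁻¹' {z}))⁻¹ * ∑ d', b d' z *
            (ψ d' (V ω) - ψ d' u + a * inner ℝ (h d' u) (inverseDirection (qs d) (h d) u)) := by
        rw [hmem]
        simp only [hρ₀, mul_add, mul_sub, Finset.sum_add_distrib, Finset.sum_sub_distrib,
          Finset.mul_sum]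
        congr 1
        exact Finset.sum_congr rfl fun d' _ => by ring
      rw [hsplit, abs_mul, abs_of_nonneg (by positivity : 0 ≤ (P.real (Z ⁻¹' {z}))⁻¹)]
      have hC₂z : (P.real (Z ⁻¹' {z}))⁻¹ * ∑ d', |b d' z| * C₁ ≤ C₂ :=
        Finset.single_le_sum (f := fun z => (P.real (Z ⁻¹' {z}))⁻¹ * ∑ d', |b d' z| * C₁)
          (fun z _ => mul_nonneg (by positivity) (Finset.sum_nonneg fun d' _ => by positivity))
          (Finset.mem_univ z)
      refine le_trans ?_ (mul_le_mul_of_nonneg_right hC₂z (sq_nonneg a))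
      rw [mul_assoc]
      refine mul_le_mul_of_nonneg_left ?_ (by positivity)
      rw [Finset.sum_mul]
      refine (Finset.abs_sum_le_sum_abs _ _).trans (Finset.sum_le_sum fun d' _ => ?_)
      rw [abs_mul, mul_assoc]
      refine mul_le_mul_of_nonneg_left ?_ (abs_nonneg _)
      exact abs_expansion_le hOc hlo hK.le hM0 hH0 ha (hgd d) (hgM d)
        (fun x hx y => mul_norm_le_norm_of_inner (hglo d x hx y)) (hqexp d) (hqO d) (hhH d)
        (hhLO d) (hhH d') (hhLO d') (hψ d') hU.1 hV.1 (hV.2.trans hU.2)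
        (fderiv_inverseDirection (hqsE d u hU.1).1))
  -- The bounds combine to `a * c ≤ C₂ * a ^ 2`, whereas `a * (C₂ + 1) < c` and `a > 0`.
  have h1 := (le_abs_self _).trans hbound
  have h2 := (mul_le_mul_of_nonneg_left hcR ha).trans h1
  rw [lt_div_iff₀ (by positivity)] at hnear
  nlinarith
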